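/- For $a,b\in\mathbb{R}$ let $N(a,b)$ be the open set $\{(x,y,z)\in\mathbb{R}^3:\lambda_a=1+a(x^2+y^2)>0\}$ with the Riemannian metric $$\frac{dx^2+dy^2}{\lambda_a^2}+\Big(dz+\frac b2\,\frac{y\,dx-x\,dy}{\lambda_a}\Big)^2 .$$ A Hopf cylinder of $N(a,b)$ is an immersed surface $(s,t)\mapsto\alpha(s)+(0,0,t)$, $s\in I$, $t\in\mathbb{R}$, where $\alpha:I\to N(a,b)$ is a smooth curve on an open interval, parametrized by arc-length and orthogonal to $\partial_z$; it is rotational if its image is invariant under the rotations about the $z$-axis. A surface is totally geodesic (totally biharmonic) if all its geodesics, parametrized by arc-length, are geodesics (biharmonic curves) of the ambient space; here a curve with unit tangent $\mathbf t$ is biharmonic if $\nabla_{\mathbf t}^3\mathbf t+R(\nabla_{\mathbf t}\mathbf t,\mathbf t)\mathbf t=0$, with $R(X,Y)=\nabla_X\nabla_Y-\nabla_Y\nabla_X-\nabla_{[X,Y]}$. Proposition. Let $4a\neq b^2$ and let $M$ be a rotational Hopf cylinder of $N(a,b)$ that is not totally geodesic. Then there is $r>0$ such that every geodesic of $M$ is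 a helix of Euclidean radius $r$ about the $z$-axis, that is, of the form $s\mapsto(r\sin(ks+\varphi),-r\cos(ks+\varphi),\nu s+c)$ (a vertical line at distance $r$ from the axis if $k=0$), and $M$ is totally biharmonic if and only if $N(a,b)$ is isometric to $(\mathbb{S}^2(4a)\setminus\{\mathrm{point}\})\times\mathbb{R}$ and $$r^2=\frac{3+2\sqrt2}{a}\quad\text{or}\quad r^2=\frac{3-2\sqrt2}{a},$$ where $\mathbb{S}^2(4a)$ is the round sphere of curvature $4a>0$. Moreover, $N(a,b)$ is isometric to $(\mathbb{S}^2(4a)\setminus\{\mathrm{point}\})\times\mathbb{R}$ if and only if $b=0$ and $a>0$. -/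

import Mathlib

open scoped ContDiff

noncomputable section

/-! ## Riemannian geometry in coordinates

A Riemannian metric on an open set of `ℝⁿ` is given by its matrix of coefficients `g i j`. -/

namespace CoordGeom

/-- A field of (metric) coefficient matrices on `ℝⁿ`. -/
abbrev MetricField (n : ℕ) := (Fin n → ℝ) → Matrix (Fin n) (Fin n) ℝ

/-- The scalar product `g_p(v, w)`. -/
def inner {n : ℕ} (g : MetricField n) (p v w : Fin n → ℝ) : ℝ :=
  ∑ i, ∑ j, g p i j * v i * w j

/-- The partial derivative `∂f/∂xⁱ` at `p`. -/
def partialDeriv {n : ℕ} {F : Type*} [NormedAddCommGroup F] [NormedSpace ℝ F]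
    (i : Fin n) (f : (Fin n → ℝ) → F) (p : Fin n → ℝ) : F :=
  fderiv ℝ f p (Pi.single i 1)

/-- The Christoffel symbols `Γᵏᵢⱼ` of the Levi-Civita connection of `g`. -/
def christoffel {n : ℕ} (g : MetricField n) (k i j : Fin n) (p : Fin n → ℝ) : ℝ :=
  (1 / 2) * ∑ l, (g p)⁻¹ k l *
    (partialDeriv i (fun q => g q j l) p + partialDeriv j (fun q => g q i l) p
      - partialDeriv l (fun q => g q i j) p)

/-- The covariant derivative `∇_{γ'} V` of a vector field `V` along a curve `γ`. -/
def covDeriv {n : ℕ} (g : MetricField n) (γ V : ℝ → Fin n → ℝ) : ℝ → Fin n → ℝ :=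
  fun s k => deriv V s k + ∑ i, ∑ j, christoffel g k i j (γ s) * deriv γ s i * V s j

/-- The components of the curvature operator: `R(∂ᵢ, ∂ⱼ) ∂ₖ = ∑ₗ (curvCoeff g l k i j) ∂ₗ`, for
`R(X, Y) = ∇_X ∇_Y - ∇_Y ∇_X - ∇_[X, Y]`. -/
def curvCoeff {n : ℕ} (g : MetricField n) (l k i j : Fin n) (p : Fin n → ℝ) : ℝ :=
  partialDeriv i (christoffel g l j k) p - partialDeriv j (christoffel g l i k) p
    + ∑ m, (christoffel g l i m p * christoffel g m j k p
      - christoffel g l j m p * christoffel g m i k p)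

/-- The curvature operator `R(X, Y) Z` at `p`. -/
def curvature {n : ℕ} (g : MetricField n) (p X Y Z : Fin n → ℝ) : Fin n → ℝ :=
  fun l => ∑ i, ∑ j, ∑ k, curvCoeff g l k i j p * X i * Y j * Z k

/-- `γ`, restricted to the nonempty open interval `J`, is a smooth curve in the open set `U` that is
parametrized by arc-length with respect to the metric `g`. -/
structure IsUnitSpeedCurve {n : ℕ} (g : MetricField n) (U : Set (Fin n → ℝ)) (J : Set ℝ)
    (γ : ℝ → Fin n → ℝ) : Prop where
  isOpen : IsOpen J
  ordConnected : J.OrdConnected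
  nonempty : J.Nonempty
  contDiffOn : ContDiffOn ℝ ∞ γ J
  mapsTo : Set.MapsTo γ J U
  unit_speed : ∀ s ∈ J, inner g (γ s) (deriv γ s) (deriv γ s) = 1

/-- Geodesics, parametrized by arc-length: `∇_t t = 0`. -/
def IsGeodesic {n : ℕ} (g : MetricField n) (U : Set (Fin n → ℝ)) (J : Set ℝ)
    (γ : ℝ → Fin n → ℝ) : Prop :=
  IsUnitSpeedCurve g U J γ ∧ ∀ s ∈ J, covDeriv g γ (deriv γ) s = 0

/-- The bitension field `∇_t³ t + R(∇_t t, t) t` of a curve `γ` with velocity `t`. -/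
def bitension {n : ℕ} (g : MetricField n) (γ : ℝ → Fin n → ℝ) (s : ℝ) : Fin n → ℝ :=
  covDeriv g γ (covDeriv g γ (covDeriv g γ (deriv γ))) s
    + curvature g (γ s) (covDeriv g γ (deriv γ) s) (deriv γ s) (deriv γ s)

/-- Biharmonic curves, parametrized by arc-length. -/
def IsBiharmonicCurve {n : ℕ} (g : MetricField n) (U : Set (Fin n → ℝ)) (J : Set ℝ)
    (γ : ℝ → Fin n → ℝ) : Prop :=
  IsUnitSpeedCurve g U J γ ∧ ∀ s ∈ J, bitension g γ s = 0

/-- The pull-back by `x` of the metric `g`; for an immersion `x` it is the induced metric. -/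
def pullback {m n : ℕ} (g : MetricField n) (x : (Fin m → ℝ) → Fin n → ℝ) : MetricField m :=
  fun u => Matrix.of fun i j => inner g (x u) (partialDeriv i x u) (partialDeriv j x u)

/-- The hypersurface `x : V → (U, g)` is totally geodesic: all geodesics of `V` with the induced
metric are geodesics of the ambient space. -/
def IsTotallyGeodesic {m n : ℕ} (g : MetricField n) (U : Set (Fin n → ℝ))
    (x : (Fin m → ℝ) → Fin n → ℝ) (V : Set (Fin m → ℝ)) : Prop :=
  ∀ (J : Set ℝ) (u : ℝ → Fin m → ℝ), IsGeodesic (pullback g x) V J u →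
    IsGeodesic g U J (fun s => x (u s))

/-- The hypersurface `x : V → (U, g)` is totally biharmonic: all geodesics of `V` with the induced
metric are biharmonic curves of the ambient space. -/
def IsTotallyBiharmonic {m n : ℕ} (g : MetricField n) (U : Set (Fin n → ℝ))
    (x : (Fin m → ℝ) → Fin n → ℝ) (V : Set (Fin m → ℝ)) : Prop :=
  ∀ (J : Set ℝ) (u : ℝ → Fin m → ℝ), IsGeodesic (pullback g x) V J u →
    IsBiharmonicCurve g U J (fun s => x (u s))

end CoordGeom

/-! ## Bianchi-Cartan-Vranceanu spaces -/

namespace BCV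

open CoordGeom

/-- `λ_a = 1 + a (x² + y²)`. -/
def lam (a : ℝ) (p : Fin 3 → ℝ) : ℝ := 1 + a * ((p 0) ^ 2 + (p 1) ^ 2)

/-- The underlying open set of `N(a, b)`. -/
def space (a : ℝ) : Set (Fin 3 → ℝ) := {p | 0 < lam a p}

/-- The coefficients of the 1-form `dz + (b / 2) (y dx - x dy) / λ_a`. -/
def contactForm (a b : ℝ) (p : Fin 3 → ℝ) : Fin 3 → ℝ :=
  ![b / 2 * (p 1 / lam a p), -(b / 2 * (p 0 / lam a p)), 1]

/-- The metric `(dx² + dy²) / λ_a² + (dz + (b / 2) (y dx - x dy) / λ_a)²` of `N(a, b)`. -/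
def metric (a b : ℝ) : MetricField 3 := fun p =>
  Matrix.diagonal ![1 / (lam a p) ^ 2, 1 / (lam a p) ^ 2, 0]
    + Matrix.vecMulVec (contactForm a b p) (contactForm a b p)

/-- The Killing vector field `E₃ = ∂/∂z`. -/
def E3 : Fin 3 → ℝ := ![0, 0, 1]

/-- The one-parameter group `ψ_t` of isometries associated with `E₃`. -/
def verticalFlow (t : ℝ) (p : Fin 3 → ℝ) : Fin 3 → ℝ := p + t • E3

/-- The action of `SO(2)` by rotations about the `z`-axis. -/
def rotation (θ : ℝ) (p : Fin 3 → ℝ) : Fin 3 → ℝ :=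
  ![Real.cos θ * p 0 - Real.sin θ * p 1, Real.sin θ * p 0 + Real.cos θ * p 1, p 2]

/-- A Hopf cylinder of `N(a, b)`: the surface `x(s, t) = ψ_t(α(s))` swept out by an arc-length
parametrized curve `α : I → N(a, b)` that is orthogonal to `E₃`. -/
structure HopfCylinder (a b : ℝ) where
  /-- the interval on which the curve is defined -/
  I : Set ℝ
  /-- the curve -/
  α : ℝ → Fin 3 → ℝ
  isUnitSpeedCurve : IsUnitSpeedCurve (metric a b) (space a) I α
  orthogonal : ∀ s ∈ I, CoordGeom.inner (metric a b) (α s) (deriv α s) E3 = 0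

namespace HopfCylinder

variable {a b : ℝ}

/-- The parameter domain `I × ℝ`. -/
def domain (M : HopfCylinder a b) : Set (Fin 2 → ℝ) := {u | u 0 ∈ M.I}

/-- The parametrization `x(s, t) = ψ_t(α(s))`. -/
def param (M : HopfCylinder a b) : (Fin 2 → ℝ) → Fin 3 → ℝ :=
  fun u => verticalFlow (u 1) (M.α (u 0))

/-- The surface is rotational: it is invariant under the action of `SO(2)`. -/
def IsRotational (M : HopfCylinder a b) : Prop :=
  ∀ θ : ℝ, ∀ p ∈ M.param '' M.domain, rotation θ p ∈ M.param '' M.domain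

/-- All geodesics of the Hopf cylinder are biharmonic curves of `N(a, b)`. -/
def TotallyBiharmonic (M : HopfCylinder a b) : Prop :=
  IsTotallyBiharmonic (metric a b) (space a) M.param M.domain

/-- All geodesics of the Hopf cylinder are geodesics of `N(a, b)`. -/
def TotallyGeodesic (M : HopfCylinder a b) : Prop :=
  IsTotallyGeodesic (metric a b) (space a) M.param M.domain

/-- `γ : J → N(a, b)` is an (arc-length parametrized) geodesic of the Hopf cylinder, seen as a curve
of the ambient space. -/
def IsGeodesicOf (M : HopfCylinder a b) (J : Set ℝ) (γ : ℝ → Fin 3 → ℝ) : Prop :=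
  ∃ u : ℝ → Fin 2 → ℝ, IsGeodesic (pullback (metric a b) M.param) M.domain J u ∧
    ∀ s ∈ J, γ s = M.param (u s)

end HopfCylinder

/-- `γ` is on `J` a helix about the `z`-axis of Euclidean radius `r`. The case `k = 0` is that of
the vertical lines at Euclidean distance `r` from the axis. -/
def IsHelix (r : ℝ) (J : Set ℝ) (γ : ℝ → Fin 3 → ℝ) : Prop :=
  ∃ k φ ν c : ℝ, ∀ s ∈ J,
    γ s = ![r * Real.sin (k * s + φ), -(r * Real.cos (k * s + φ)), ν * s + c]

/-- The product `(𝕊²(ρ) - {∞}) × ℝ ⊆ ℝ³ × ℝ = ℝ⁴`, where `𝕊²(ρ)` is the round sphere of curvature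
`ρ > 0`, that is, of radius `1 / √ρ`, and `∞` is its north pole. -/
def puncturedSphereTimesLine (ρ : ℝ) : Set (Fin 4 → ℝ) :=
  {q | (q 0) ^ 2 + (q 1) ^ 2 + (q 2) ^ 2 = 1 / ρ ∧ ¬ (q 0 = 0 ∧ q 1 = 0 ∧ q 2 = 1 / Real.sqrt ρ)}

/-- `N(a, b)` is isometric to `(𝕊²(ρ) - {∞}) × ℝ` with `ρ > 0`: there is a smooth bijection onto
this submanifold of `ℝ⁴` that pulls the Euclidean metric back to the metric of `N(a, b)`. -/
def IsometricToSphereTimesLine (a b ρ : ℝ) : Prop :=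
  0 < ρ ∧ ∃ Φ : (Fin 3 → ℝ) → Fin 4 → ℝ,
    ContDiffOn ℝ ∞ Φ (space a) ∧
    Set.BijOn Φ (space a) (puncturedSphereTimesLine ρ) ∧
    ∀ p ∈ space a, pullback (fun _ => 1) Φ p = metric a b p

end BCV

end

/-! A smooth plane curve has dense complement, whereas rotating a point set that takes two distinct
radii sweeps out an annulus. Hence the base curve of a rotational Hopf cylinder keeps a constant
distance `r` from the axis, and unit speed and horizontality force it to be a helix
(`exists_curve_eq_helix`). Since the Hopf cylinder is flat in the coordinates `(s, t)`
(`pullback_param`), its geodesics are straight lines there, and lines become helices of the same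
radius.

Along such a helix, covariant differentiation exchanges the radial field with fields of constant
tangential and vertical coefficients. So the bitension field is a constant times the radial field
(`bitension_helix`). The constant depends on the direction of the line, through the angular velocity
and the scalar product `C` of the velocity with `E₃`. Total biharmonicity means that it vanishes for
all directions. Three test directions give `b = 0` and `(1 - a r²)² = 4 a r²`, once `4a = b²` and
the totally geodesic case `b = 0`, `a r² = 1` are excluded. Conversely, for `b = 0` this one
equation serves all directions. It is quadratic in `a r²`, with roots `3 ± 2√2`.

For the isometry statement, stereographic projection settles `b = 0`, `a > 0`. If `b ≠ 0`, the line
coordinate of an isometry would have parallel gradient on `N(a, b)`. The non-integrability of the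
horizontal planes makes this gradient vanish (`partialDeriv_eq_zero_of_hessian`), although the axis
of `𝕊² × ℝ` is tangent to the image. -/

open scoped ContDiff

noncomputable section

/-! ### Calculus of coordinate partial derivatives. -/

namespace CoordGeom

variable {n : ℕ}

theorem partialDeriv_eq_of_hasFDerivAt {F : Type*} [NormedAddCommGroup F] [NormedSpace ℝ F]
    {f : (Fin n → ℝ) → F} {f' : (Fin n → ℝ) →L[ℝ] F} {p : Fin n → ℝ} (i : Fin n)
    (h : HasFDerivAt f f' p) : partialDeriv i f p = f' (Pi.single i 1) := by
  rw [partialDeriv, h.fderiv]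

theorem partialDeriv_congr {F : Type*} [NormedAddCommGroup F] [NormedSpace ℝ F]
    {f g : (Fin n → ℝ) → F} {p : Fin n → ℝ} (i : Fin n) (h : f =ᶠ[nhds p] g) :
    partialDeriv i f p = partialDeriv i g p := by
  rw [partialDeriv, partialDeriv, h.fderiv_eq]

theorem partialDeriv_const {F : Type*} [NormedAddCommGroup F] [NormedSpace ℝ F]
    (c : F) (p : Fin n → ℝ) (i : Fin n) : partialDeriv i (fun _ => c) p = 0 := by
  simp [partialDeriv]

theorem partialDeriv_add {f g : (Fin n → ℝ) → ℝ} {p : Fin n → ℝ} (i : Fin n)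
    (hf : DifferentiableAt ℝ f p) (hg : DifferentiableAt ℝ g p) :
    partialDeriv i (fun q => f q + g q) p = partialDeriv i f p + partialDeriv i g p := by
  rw [partialDeriv_eq_of_hasFDerivAt i (hf.hasFDerivAt.fun_add hg.hasFDerivAt)]
  rfl

theorem partialDeriv_mul {f g : (Fin n → ℝ) → ℝ} {p : Fin n → ℝ} (i : Fin n)
    (hf : DifferentiableAt ℝ f p) (hg : DifferentiableAt ℝ g p) :
    partialDeriv i (fun q => f q * g q) p
      = partialDeriv i f p * g p + f p * partialDeriv i g p := by
  rw [partialDeriv_eq_of_hasFDerivAt i (hf.hasFDerivAt.fun_mul hg.hasFDerivAt)]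
  simp [partialDeriv]
  ring

theorem partialDeriv_const_mul {f : (Fin n → ℝ) → ℝ} {p : Fin n → ℝ} (i : Fin n) (c : ℝ)
    (hf : DifferentiableAt ℝ f p) :
    partialDeriv i (fun q => c * f q) p = c * partialDeriv i f p := by
  rw [partialDeriv_eq_of_hasFDerivAt i (hf.hasFDerivAt.const_mul c)]
  rfl

theorem partialDeriv_inv {f : (Fin n → ℝ) → ℝ} {p : Fin n → ℝ} (i : Fin n)
    (hf : DifferentiableAt ℝ f p) (h0 : f p ≠ 0) :
    partialDeriv i (fun q => (f q)⁻¹) p = -partialDeriv i f p * (f p)⁻¹ ^ 2 := by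
  refine (partialDeriv_eq_of_hasFDerivAt i
    ((hasDerivAt_inv h0).comp_hasFDerivAt p hf.hasFDerivAt)).trans ?_
  simp [partialDeriv]
  ring

theorem partialDeriv_coord (i j : Fin n) (p : Fin n → ℝ) :
    partialDeriv i (fun q => q j) p = if j = i then 1 else 0 := by
  rw [partialDeriv_eq_of_hasFDerivAt i (hasFDerivAt_apply j p)]
  simp [Pi.single_apply]

end CoordGeom

/-! ### The metric of `N(a, b)` and its Christoffel symbols. -/

namespace BCV

open CoordGeom

variable {a b : ℝ} {p : Fin 3 → ℝ}

theorem contDiff_lam : ContDiff ℝ ∞ (lam a) := by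
  unfold lam
  fun_prop

theorem differentiableAt_lam : DifferentiableAt ℝ (lam a) p :=
  contDiff_lam.contDiffAt.differentiableAt (by simp)

theorem isOpen_space : IsOpen (space a) :=
  isOpen_lt continuous_const contDiff_lam.continuous

/-- The conformal factor `1 / λ_a` of the base metric. -/
def conf (a : ℝ) (p : Fin 3 → ℝ) : ℝ := (lam a p)⁻¹

/-- The coordinates `x` and `y` divided by `λ_a`. -/
def scaled (a : ℝ) (j : Fin 3) (p : Fin 3 → ℝ) : ℝ := p j * conf a p

/-- The partial derivatives of `conf`. -/
def dconf (a : ℝ) (i : Fin 3) (p : Fin 3 → ℝ) : ℝ :=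
  ![-(2 * a * p 0 * conf a p ^ 2), -(2 * a * p 1 * conf a p ^ 2), 0] i

/-- The partial derivatives of `scaled`. -/
def dscaled (a : ℝ) (i j : Fin 3) (p : Fin 3 → ℝ) : ℝ :=
  (if j = i then 1 else 0) * conf a p + p j * dconf a i p

theorem partialDeriv_lam (i : Fin 3) :
    partialDeriv i (lam a) p = ![2 * a * p 0, 2 * a * p 1, 0] i := by
  have h : HasFDerivAt (lam a) (a • ((2 * p 0) • ContinuousLinearMap.proj (R := ℝ) (φ := fun _ : Fin 3 => ℝ) 0
      + (2 * p 1) • ContinuousLinearMap.proj (R := ℝ) (φ := fun _ : Fin 3 => ℝ) 1)) p := by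
    have h0 := (hasFDerivAt_apply (𝕜 := ℝ) (0 : Fin 3) p).pow 2
    have h1 := (hasFDerivAt_apply (𝕜 := ℝ) (1 : Fin 3) p).pow 2
    have := ((h0.add h1).const_mul a).const_add 1
    refine this.congr_fderiv ?_
    ext v
    simp
  rw [partialDeriv_eq_of_hasFDerivAt i h]
  fin_cases i <;> simp <;> ring

theorem differentiableAt_conf (hp : p ∈ space a) : DifferentiableAt ℝ (conf a) p :=
  differentiableAt_lam.fun_inv (ne_of_gt hp)

theorem partialDeriv_conf (hp : p ∈ space a) (i : Fin 3) :
    partialDeriv i (conf a) p = dconf a i p := by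
  have := partialDeriv_inv i (differentiableAt_lam (a := a) (p := p)) (ne_of_gt hp)
  change partialDeriv i (fun q => (lam a q)⁻¹) p = _
  rw [this, partialDeriv_lam]
  fin_cases i <;> simp [dconf, conf]

theorem differentiableAt_scaled (hp : p ∈ space a) (j : Fin 3) :
    DifferentiableAt ℝ (scaled a j) p :=
  (differentiableAt_apply j p).fun_mul (differentiableAt_conf hp)

theorem partialDeriv_scaled (hp : p ∈ space a) (i j : Fin 3) :
    partialDeriv i (scaled a j) p = dscaled a i j p := by
  change partialDeriv i (fun q => q j * conf a q) p = _
  rw [partialDeriv_mul i (differentiableAt_apply j p) (differentiableAt_conf hp),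
    partialDeriv_coord, partialDeriv_conf hp, dscaled]

theorem contactForm_eq (a b : ℝ) (p : Fin 3 → ℝ) :
    contactForm a b p = ![b / 2 * scaled a 1 p, -(b / 2) * scaled a 0 p, 1] := by
  simp [contactForm, scaled, conf, div_eq_mul_inv]

/-- The partial derivatives of the coefficients of the contact form. -/
def dcontact (a b : ℝ) (i j : Fin 3) (p : Fin 3 → ℝ) : ℝ :=
  ![b / 2 * dscaled a i 1 p, -(b / 2) * dscaled a i 0 p, 0] j

theorem differentiableAt_contactForm (hp : p ∈ space a) (j : Fin 3) :
    DifferentiableAt ℝ (fun q => contactForm a b q j) p := by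
  simp only [contactForm_eq]
  fin_cases j
  · exact (differentiableAt_scaled hp 1).const_mul _
  · exact (differentiableAt_scaled hp 0).const_mul _
  · exact differentiableAt_const _

theorem partialDeriv_contactForm (hp : p ∈ space a) (i j : Fin 3) :
    partialDeriv i (fun q => contactForm a b q j) p = dcontact a b i j p := by
  simp only [contactForm_eq]
  fin_cases j
  · have := partialDeriv_const_mul i (b / 2) (differentiableAt_scaled hp 1)
    simpa [dcontact, partialDeriv_scaled hp] using this
  · have := partialDeriv_const_mul i (-(b / 2)) (differentiableAt_scaled hp 0)
    simpa [dcontact, partialDeriv_scaled hp] using this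
  · simpa [dcontact] using partialDeriv_const (1 : ℝ) p i

theorem metric_apply (a b : ℝ) (p : Fin 3 → ℝ) (i j : Fin 3) :
    metric a b p i j = (if i = j ∧ i ≠ 2 then 1 else 0) * (conf a p * conf a p)
      + contactForm a b p i * contactForm a b p j := by
  fin_cases i <;> fin_cases j <;>
    simp [metric, conf, Matrix.vecMulVec_apply] <;> ring

theorem partialDeriv_metric (hp : p ∈ space a) (i j l : Fin 3) :
    partialDeriv i (fun q => metric a b q j l) p
      = (if j = l ∧ j ≠ 2 then 1 else 0) * (2 * conf a p * dconf a i p)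
        + (dcontact a b i j p * contactForm a b p l
          + contactForm a b p j * dcontact a b i l p) := by
  simp only [metric_apply]
  have hc := differentiableAt_conf hp
  have hj := differentiableAt_contactForm (b := b) hp j
  have hl := differentiableAt_contactForm (b := b) hp l
  rw [partialDeriv_add i ((hc.fun_mul hc).const_mul _) (hj.fun_mul hl),
    partialDeriv_const_mul i _ (hc.fun_mul hc), partialDeriv_mul i hc hc, partialDeriv_mul i hj hl,
    partialDeriv_conf hp, partialDeriv_contactForm hp, partialDeriv_contactForm hp]
  ring

/-- The coefficients of the inverse of the metric of `N(a, b)`. -/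
def metricInv (a b : ℝ) (p : Fin 3 → ℝ) : Matrix (Fin 3) (Fin 3) ℝ :=
  !![lam a p ^ 2, 0, -(b / 2 * p 1 * lam a p);
    0, lam a p ^ 2, b / 2 * p 0 * lam a p;
    -(b / 2 * p 1 * lam a p), b / 2 * p 0 * lam a p, 1 + (b / 2) ^ 2 * (p 0 ^ 2 + p 1 ^ 2)]

theorem metric_inv (hp : p ∈ space a) : (metric a b p)⁻¹ = metricInv a b p := by
  have h0 : lam a p ≠ 0 := ne_of_gt hp
  refine Matrix.inv_eq_right_inv ?_
  ext i j
  rw [Matrix.mul_apply, Fin.sum_univ_three]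
  simp only [metric_apply, contactForm, conf]
  fin_cases i <;> fin_cases j <;> simp [metricInv] <;> field_simp <;> ring

/-- The Christoffel symbols of `N(a, b)`, with `u = b / 2`, as polynomials in `A = x / λ_a` and
`B = y / λ_a`. -/
def gammaTable (a u A B : ℝ) : Fin 3 → Matrix (Fin 3) (Fin 3) ℝ :=
  ![!![-2 * a * A, (u ^ 2 - 2 * a) * B, 0;
      (u ^ 2 - 2 * a) * B, 2 * (a - u ^ 2) * A, u;
      0, u, 0],
    !![2 * (a - u ^ 2) * B, (u ^ 2 - 2 * a) * A, -u;
      (u ^ 2 - 2 * a) * A, -2 * a * B, 0;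
      -u, 0, 0],
    !![2 * u * (a - u ^ 2) * (A * B), u * (u ^ 2 - a) * (A * A - B * B), -u ^ 2 * A;
      u * (u ^ 2 - a) * (A * A - B * B), -2 * u * (a - u ^ 2) * (A * B), -u ^ 2 * B;
      -u ^ 2 * A, -u ^ 2 * B, 0]]

-- All powers of `λ_a` are absorbed into `x / λ_a` and `y / λ_a`. The polynomial form makes the next
-- derivative, needed for the curvature, mechanical.
set_option maxHeartbeats 1000000 in
theorem christoffel_eq (hp : p ∈ space a) (k i j : Fin 3) :
    christoffel (metric a b) k i j p
      = gammaTable a (b / 2) (scaled a 0 p) (scaled a 1 p) k i j := by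
  have h0 : lam a p ≠ 0 := ne_of_gt hp
  simp only [christoffel, metric_inv hp, partialDeriv_metric hp, Fin.sum_univ_three]
  simp only [dcontact, contactForm_eq, dscaled, dconf, scaled, conf]
  have hl : lam a p = 1 + a * (p 0 ^ 2 + p 1 ^ 2) := rfl
  rw [hl] at h0
  simp only [metricInv, gammaTable, hl]
  fin_cases k <;> fin_cases i <;> fin_cases j <;> simp <;> field_simp <;> ring

end BCV

/-! ### The curvature of `N(a, b)` along helices. -/

namespace BCV

open CoordGeom

variable {a b : ℝ} {p : Fin 3 → ℝ}

/-- The derivative of `gammaTable` in the direction `(A', B')`. -/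
def dgammaTable (a u A B A' B' : ℝ) : Fin 3 → Matrix (Fin 3) (Fin 3) ℝ :=
  ![!![-2 * a * A', (u ^ 2 - 2 * a) * B', 0;
      (u ^ 2 - 2 * a) * B', 2 * (a - u ^ 2) * A', 0;
      0, 0, 0],
    !![2 * (a - u ^ 2) * B', (u ^ 2 - 2 * a) * A', 0;
      (u ^ 2 - 2 * a) * A', -2 * a * B', 0;
      0, 0, 0],
    !![2 * u * (a - u ^ 2) * (A' * B + A * B'), u * (u ^ 2 - a) * (2 * (A * A' - B * B')),
        -u ^ 2 * A';
      u * (u ^ 2 - a) * (2 * (A * A' - B * B')), -2 * u * (a - u ^ 2) * (A' * B + A * B'),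
        -u ^ 2 * B';
      -u ^ 2 * A', -u ^ 2 * B', 0]]

/-- Up to constant factors, only `A`, `B`, `A B`, `A² - B²` and constants occur as entries, so five
differentiation rules suffice. -/
theorem partialDeriv_gammaTable (a u : ℝ) {f g : (Fin 3 → ℝ) → ℝ} (hf : DifferentiableAt ℝ f p)
    (hg : DifferentiableAt ℝ g p) (i l j k : Fin 3) :
    partialDeriv i (fun q => gammaTable a u (f q) (g q) l j k) p
      = dgammaTable a u (f p) (g p) (partialDeriv i f p) (partialDeriv i g p) l j k := by
  have h1 := fun c : ℝ => partialDeriv_const_mul i c hf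
  have h2 := fun c : ℝ => partialDeriv_const_mul i c hg
  have h3 : ∀ c : ℝ, partialDeriv i (fun q => c * (f q * g q)) p
      = c * (partialDeriv i f p * g p + f p * partialDeriv i g p) := fun c => by
    rw [partialDeriv_const_mul i c (hf.fun_mul hg), partialDeriv_mul i hf hg]
  have h4 : ∀ c : ℝ, partialDeriv i (fun q => c * (f q * f q - g q * g q)) p
      = c * (2 * (f p * partialDeriv i f p - g p * partialDeriv i g p)) := fun c => by
    have e : (fun q => f q * f q - g q * g q) = fun q => f q * f q + -1 * (g q * g q) := by
      ext q; ring
    rw [partialDeriv_const_mul i c ((hf.fun_mul hf).fun_sub (hg.fun_mul hg)), e,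
      partialDeriv_add i (hf.fun_mul hf) ((hg.fun_mul hg).const_mul _),
      partialDeriv_const_mul i _ (hg.fun_mul hg), partialDeriv_mul i hf hf,
      partialDeriv_mul i hg hg]
    ring
  have h5 := fun c : ℝ => partialDeriv_const c p i
  fin_cases l <;> fin_cases j <;> fin_cases k <;>
    first | exact h1 _ | exact h2 _ | exact h3 _ | exact h4 _ | exact h5 _

theorem partialDeriv_christoffel (hp : p ∈ space a) (i l j k : Fin 3) :
    partialDeriv i (christoffel (metric a b) l j k) p
      = dgammaTable a (b / 2) (scaled a 0 p) (scaled a 1 p) (dscaled a i 0 p) (dscaled a i 1 p)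
        l j k := by
  rw [← partialDeriv_scaled hp, ← partialDeriv_scaled hp,
    ← partialDeriv_gammaTable _ _ (differentiableAt_scaled hp 0) (differentiableAt_scaled hp 1)]
  refine partialDeriv_congr i ?_
  filter_upwards [isOpen_space.mem_nhds hp] with q hq
  exact christoffel_eq hq l j k

/-- Swapping the summation indices `i`, `j` in half of the terms moves the antisymmetry onto `X` and
`Y`, which halves the expression to be computed. -/
theorem curvature_antisymm {n : ℕ} (g : MetricField n) (p X Y Z : Fin n → ℝ) (l : Fin n) :
    curvature g p X Y Z l = ∑ i, ∑ j, ∑ k, (partialDeriv i (christoffel g l j k) p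
      + ∑ m, christoffel g l i m p * christoffel g m j k p) * (X i * Y j - X j * Y i) * Z k := by
  have h : ∀ i j k, curvCoeff g l k i j p * X i * Y j * Z k
      = (partialDeriv i (christoffel g l j k) p
        + ∑ m, christoffel g l i m p * christoffel g m j k p) * (X i * Y j) * Z k
      - (partialDeriv j (christoffel g l i k) p
        + ∑ m, christoffel g l j m p * christoffel g m i k p) * (X i * Y j) * Z k := by
    intro i j k
    rw [curvCoeff, Finset.sum_sub_distrib]
    ring
  simp only [curvature, h, Finset.sum_sub_distrib, mul_sub, sub_mul]
  congr 1
  exact Finset.sum_comm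

set_option maxHeartbeats 4000000 in
/-- `R(X, t) t` for the horizontal radial vector `X` and the velocity `t` of a helix. -/
theorem curvature_radial (hp : p ∈ space a) (k ν : ℝ) :
    curvature (metric a b) p ![p 0, p 1, 0] ![-(k * p 1), k * p 0, ν] ![-(k * p 1), k * p 0, ν]
      = (k ^ 2 * (p 0 ^ 2 + p 1 ^ 2) * conf a p ^ 2 * (4 * a - 3 * (b / 2) ^ 2)
        + (ν - b / 2 * k * conf a p * (p 0 ^ 2 + p 1 ^ 2)) ^ 2 * (b / 2) ^ 2)
        • ![p 0, p 1, 0] := by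
  have h0 : lam a p ≠ 0 := ne_of_gt hp
  have hl : lam a p = 1 + a * (p 0 ^ 2 + p 1 ^ 2) := rfl
  rw [hl] at h0
  ext l
  simp only [curvature_antisymm, partialDeriv_christoffel hp, christoffel_eq hp,
    Fin.sum_univ_three, dscaled, dconf, scaled, conf, hl]
  generalize p 0 = x at *
  generalize p 1 = y at *
  generalize b / 2 = u at *
  fin_cases l <;> simp [gammaTable, dgammaTable] <;> field_simp <;> ring

end BCV

/-! ### Locality of covariant derivatives and of the bitension field. -/

namespace CoordGeom

variable {n : ℕ} {g : MetricField n} {U : Set (Fin n → ℝ)} {J : Set ℝ}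
  {γ δ V W : ℝ → Fin n → ℝ}

theorem deriv_eqOn (hJ : IsOpen J) (h : Set.EqOn V W J) : Set.EqOn (deriv V) (deriv W) J :=
  h.deriv hJ

theorem covDeriv_eqOn (hJ : IsOpen J) (hγ : Set.EqOn γ δ J) (hV : Set.EqOn V W J) :
    Set.EqOn (covDeriv g γ V) (covDeriv g δ W) J := by
  intro s hs
  ext k
  simp only [covDeriv, hγ hs, hV hs, deriv_eqOn hJ hγ hs, deriv_eqOn hJ hV hs]

theorem covDeriv_deriv_eqOn (hJ : IsOpen J) (hγ : Set.EqOn γ δ J) :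
    Set.EqOn (covDeriv g γ (deriv γ)) (covDeriv g δ (deriv δ)) J :=
  covDeriv_eqOn hJ hγ (deriv_eqOn hJ hγ)

/-- Derivatives on an open set see only the values there, so a geodesic controlled only on `J` can
be replaced by a helix defined on all of `ℝ`. -/
theorem bitension_eqOn (hJ : IsOpen J) (hγ : Set.EqOn γ δ J) :
    Set.EqOn (bitension g γ) (bitension g δ) J := by
  intro s hs
  have h1 := covDeriv_deriv_eqOn (g := g) hJ hγ
  have h3 := covDeriv_eqOn (g := g) hJ hγ (covDeriv_eqOn (g := g) hJ hγ h1)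
  simp only [bitension, h3 hs, h1 hs, hγ hs, deriv_eqOn hJ hγ hs]

theorem IsUnitSpeedCurve.congr (h : IsUnitSpeedCurve g U J γ) (e : Set.EqOn δ γ J) :
    IsUnitSpeedCurve g U J δ where
  isOpen := h.isOpen
  ordConnected := h.ordConnected
  nonempty := h.nonempty
  contDiffOn := h.contDiffOn.congr e
  mapsTo := h.mapsTo.congr e.symm
  unit_speed := fun s hs => by
    rw [e hs, deriv_eqOn h.isOpen e hs]
    exact h.unit_speed s hs

end CoordGeom

/-! ### The bitension field of a helix. -/

namespace BCV

open CoordGeom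

/-- A parametrization of the helix of Euclidean radius `r` about the `z`-axis. -/
def helix (r k φ ν c s : ℝ) : Fin 3 → ℝ :=
  ![r * Real.sin (k * s + φ), -(r * Real.cos (k * s + φ)), ν * s + c]

variable {a b r k φ ν c : ℝ}

theorem helix_sq (r k φ ν c s : ℝ) :
    helix r k φ ν c s 0 ^ 2 + helix r k φ ν c s 1 ^ 2 = r ^ 2 := by
  simp only [helix, Matrix.cons_val_zero, Matrix.cons_val_one]
  linear_combination r ^ 2 * Real.sin_sq_add_cos_sq (k * s + φ)

theorem lam_helix (s : ℝ) : lam a (helix r k φ ν c s) = 1 + a * r ^ 2 := by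
  rw [lam, helix_sq]

theorem helix_mem_space (h : 0 < 1 + a * r ^ 2) (s : ℝ) : helix r k φ ν c s ∈ space a := by
  change 0 < lam a _
  rwa [lam_helix]

theorem hasDerivAt_helix_zero (s : ℝ) :
    HasDerivAt (fun s => helix r k φ ν c s 0) (-(k * helix r k φ ν c s 1)) s := by
  have h : HasDerivAt (fun s => k * s + φ) k s := by
    simpa using ((hasDerivAt_id s).const_mul k).add_const φ
  refine (h.sin.const_mul r).congr_deriv ?_
  simp only [helix, Matrix.cons_val_one, Matrix.cons_val_zero]
  ring

theorem hasDerivAt_helix_one (s : ℝ) :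
    HasDerivAt (fun s => helix r k φ ν c s 1) (k * helix r k φ ν c s 0) s := by
  have h : HasDerivAt (fun s => k * s + φ) k s := by
    simpa using ((hasDerivAt_id s).const_mul k).add_const φ
  refine (h.cos.const_mul r).neg.congr_deriv ?_
  simp only [helix, Matrix.cons_val_zero]
  ring

theorem hasDerivAt_helix (s : ℝ) : HasDerivAt (helix r k φ ν c)
    ![-(k * helix r k φ ν c s 1), k * helix r k φ ν c s 0, ν] s := by
  rw [hasDerivAt_pi]
  intro i
  fin_cases i
  · exact hasDerivAt_helix_zero s
  · exact hasDerivAt_helix_one s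
  · simpa [helix] using ((hasDerivAt_id s).const_mul ν).add_const c

theorem deriv_helix : deriv (helix r k φ ν c)
    = fun s => ![-(k * helix r k φ ν c s 1), k * helix r k φ ν c s 0, ν] :=
  funext fun s => (hasDerivAt_helix s).deriv

theorem contDiff_helix : ContDiff ℝ ∞ (helix r k φ ν c) := by
  rw [contDiff_pi]
  intro i
  fin_cases i <;> simp [helix] <;> fun_prop

/-- The rotating vector field along a helix with tangential coefficient `q` and vertical coefficient
`σ`. -/
def tangential (r k φ ν c q σ s : ℝ) : Fin 3 → ℝ :=
  ![-(q * helix r k φ ν c s 1), q * helix r k φ ν c s 0, σ]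

/-- The horizontal radial vector field along a helix. -/
def radial (r k φ ν c s : ℝ) : Fin 3 → ℝ := ![helix r k φ ν c s 0, helix r k φ ν c s 1, 0]

theorem covDeriv_metric {γ V : ℝ → Fin 3 → ℝ} {s : ℝ} (hs : γ s ∈ space a) (l : Fin 3) :
    covDeriv (metric a b) γ V s l = deriv V s l + ∑ i, ∑ j,
      gammaTable a (b / 2) (scaled a 0 (γ s)) (scaled a 1 (γ s)) l i j * deriv γ s i * V s j := by
  simp only [covDeriv, christoffel_eq hs]

/-- Screw motions along the helix are isometries, so coefficients are constant. The half-turn about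
the horizontal line from the axis to a point of the helix is also an isometry. It reverses the helix
and, at that point, fixes radial vectors and negates tangential and vertical ones. This leaves only
a radial component here, and none in `covDeriv_radial`. The coefficients come from direct
computation. -/
theorem covDeriv_tangential (h : 0 < 1 + a * r ^ 2) (q σ : ℝ) :
    covDeriv (metric a b) (helix r k φ ν c) (tangential r k φ ν c q σ)
      = fun s => (-(k * q) + 2 * k * q * r ^ 2 / (1 + a * r ^ 2) * (a - (b / 2) ^ 2)
          + b / 2 * (k * σ + q * ν)) • radial r k φ ν c s := by
  ext s l
  have hd : deriv (tangential r k φ ν c q σ) s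
      = ![-(q * (k * helix r k φ ν c s 0)), q * -(k * helix r k φ ν c s 1), 0] := by
    refine HasDerivAt.deriv ?_
    rw [hasDerivAt_pi]
    intro i
    fin_cases i
    · exact ((hasDerivAt_helix_one s).const_mul q).neg
    · exact (hasDerivAt_helix_zero s).const_mul q
    · exact hasDerivAt_const s σ
  rw [covDeriv_metric (helix_mem_space h s), hd, deriv_helix]
  simp only [tangential, radial, scaled, conf, lam_helix, ← helix_sq r k φ ν c s] at h ⊢
  generalize helix r k φ ν c s = p at *
  generalize p 0 = x at *
  generalize p 1 = y at *
  generalize b / 2 = u at *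
  have h0 := h.ne'
  fin_cases l <;> simp [gammaTable, Fin.sum_univ_three] <;> field_simp <;> ring

theorem covDeriv_radial (h : 0 < 1 + a * r ^ 2) (d : ℝ) :
    covDeriv (metric a b) (helix r k φ ν c) (fun s => d • radial r k φ ν c s)
      = tangential r k φ ν c
        (d * (k - k * r ^ 2 / (1 + a * r ^ 2) * (2 * a - (b / 2) ^ 2) - b / 2 * ν))
        (d * (-(k * (b / 2) * (a - (b / 2) ^ 2) * (r ^ 2 / (1 + a * r ^ 2)) ^ 2)
          - (b / 2) ^ 2 * (r ^ 2 / (1 + a * r ^ 2)) * ν)) := by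
  ext s l
  have hd : deriv (fun s => d • radial r k φ ν c s) s
      = ![d * (-(k * helix r k φ ν c s 1)), d * (k * helix r k φ ν c s 0), 0] := by
    refine HasDerivAt.deriv ?_
    rw [hasDerivAt_pi]
    intro i
    fin_cases i
    · exact (hasDerivAt_helix_zero s).const_mul d
    · exact (hasDerivAt_helix_one s).const_mul d
    · simpa [radial] using hasDerivAt_const s (0 : ℝ)
  rw [covDeriv_metric (helix_mem_space h s), hd, deriv_helix]
  simp only [tangential, radial, scaled, conf, lam_helix, ← helix_sq r k φ ν c s] at h ⊢
  generalize helix r k φ ν c s = p at *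
  generalize p 0 = x at *
  generalize p 1 = y at *
  generalize b / 2 = u at *
  have h0 := h.ne'
  fin_cases l <;> simp [gammaTable, Fin.sum_univ_three] <;> field_simp <;> ring

/-- The helix is written in terms of its angular velocity `k` and of the constant scalar product `C`
of its velocity with `E₃`. -/
theorem covDeriv_deriv_helix (h : 0 < 1 + a * r ^ 2) (C : ℝ)
    (hν : ν = C + b / 2 * k * r ^ 2 / (1 + a * r ^ 2)) (s : ℝ) :
    covDeriv (metric a b) (helix r k φ ν c) (deriv (helix r k φ ν c)) s
      = (k * (b * C - k * ((1 - a * r ^ 2) / (1 + a * r ^ 2)))) • radial r k φ ν c s := by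
  have e : deriv (helix r k φ ν c) = tangential r k φ ν c k ν := deriv_helix
  rw [e, covDeriv_tangential h]
  have h0 := h.ne'
  beta_reduce
  congr 1
  rw [hν]
  linear_combination k ^ 2 * mul_inv_cancel₀ h0

set_option maxHeartbeats 1000000 in
theorem bitension_helix (h : 0 < 1 + a * r ^ 2) (C : ℝ)
    (hν : ν = C + b / 2 * k * r ^ 2 / (1 + a * r ^ 2)) (s : ℝ) :
    bitension (metric a b) (helix r k φ ν c) s
      = (k * (b * C - k * ((1 - a * r ^ 2) / (1 + a * r ^ 2)))
          * (k * (k * (4 * a - b ^ 2) * (r / (1 + a * r ^ 2)) ^ 2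
            - k * ((1 - a * r ^ 2) / (1 + a * r ^ 2)) ^ 2
            + b * C * ((1 - a * r ^ 2) / (1 + a * r ^ 2))))) • radial r k φ ν c s := by
  have h1 := funext (covDeriv_deriv_helix (φ := φ) (c := c) (b := b) h C hν)
  have e : deriv (helix r k φ ν c) s
    = ![-(k * helix r k φ ν c s 1), k * helix r k φ ν c s 0, ν] := by rw [deriv_helix]
  have lin : ∀ (d : ℝ) (p X Y Z : Fin 3 → ℝ),
      curvature (metric a b) p (d • X) Y Z = d • curvature (metric a b) p X Y Z := by
    intro d p X Y Z
    ext l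
    simp only [curvature, Pi.smul_apply, smul_eq_mul, Finset.mul_sum]
    refine Finset.sum_congr rfl fun _ _ => Finset.sum_congr rfl fun _ _ =>
      Finset.sum_congr rfl fun _ _ => by ring
  -- The curvature term is radial too, so the whole bitension field reduces to one scalar
  -- coefficient.
  have hc : curvature (metric a b) (helix r k φ ν c s) (radial r k φ ν c s) _ _
      = _ • radial r k φ ν c s :=
    curvature_radial (b := b) (helix_mem_space (k := k) (φ := φ) (ν := ν) (c := c) h s) k ν
  rw [bitension, h1, covDeriv_radial h, covDeriv_tangential h, e, lin, hc, helix_sq, conf,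
    lam_helix, smul_smul]
  beta_reduce
  rw [← add_smul]
  have h0 := h.ne'
  congr 1
  rw [hν]
  field_simp
  ring

theorem inner_metric (a b : ℝ) (p v w : Fin 3 → ℝ) :
    CoordGeom.inner (metric a b) p v w = (v 0 * w 0 + v 1 * w 1) / lam a p ^ 2
      + (b / 2 * (p 1 / lam a p) * v 0 - b / 2 * (p 0 / lam a p) * v 1 + v 2)
        * (b / 2 * (p 1 / lam a p) * w 0 - b / 2 * (p 0 / lam a p) * w 1 + w 2) := by
  simp only [CoordGeom.inner, metric_apply, Fin.sum_univ_three, contactForm, conf]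
  simp
  ring

theorem inner_deriv_helix (h : 0 < 1 + a * r ^ 2) (C : ℝ)
    (hν : ν = C + b / 2 * k * r ^ 2 / (1 + a * r ^ 2)) (s : ℝ) :
    CoordGeom.inner (metric a b) (helix r k φ ν c s) (deriv (helix r k φ ν c) s)
      (deriv (helix r k φ ν c) s) = (k * r / (1 + a * r ^ 2)) ^ 2 + C ^ 2 := by
  rw [inner_metric, deriv_helix, lam_helix]
  have h2 := helix_sq r k φ ν c s
  have h0 := h.ne'
  simp only [Matrix.cons_val]
  generalize helix r k φ ν c s = p at *
  have e : b / 2 * (p 1 / (1 + a * r ^ 2)) * -(k * p 1) - b / 2 * (p 0 / (1 + a * r ^ 2)) * (k * p 0)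
      + ν = C := by
    rw [hν]
    field_simp
    linear_combination (-b * k) * h2
  have e2 : -(k * p 1) * -(k * p 1) + k * p 0 * (k * p 0) = k ^ 2 * r ^ 2 := by
    linear_combination k ^ 2 * h2
  rw [e, e2]
  field_simp

end BCV

/-! ### The base curve of a rotational Hopf cylinder. -/

theorem exists_eq_cos_sin {c d : ℝ} (h : c ^ 2 + d ^ 2 = 1) :
    ∃ θ : ℝ, c = Real.cos θ ∧ d = Real.sin θ := by
  have h1 : ‖(⟨c, d⟩ : ℂ)‖ = 1 := by
    rw [Complex.norm_def, Complex.normSq_mk, ← sq, ← sq, h, Real.sqrt_one]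
  refine ⟨Complex.arg ⟨c, d⟩, ?_, ?_⟩
  · simpa [h1] using (Complex.norm_mul_cos_arg ⟨c, d⟩).symm
  · simpa [h1] using (Complex.norm_mul_sin_arg ⟨c, d⟩).symm

theorem exists_const_of_hasDerivAt_zero {J : Set ℝ} (hJ : IsOpen J) (hJ' : J.OrdConnected)
    {f : ℝ → ℝ} (hf : ∀ s ∈ J, HasDerivAt f 0 s) : ∃ c, ∀ s ∈ J, f s = c :=
  hJ.exists_is_const_of_deriv_eq_zero hJ'.isPreconnected
    (fun s hs => (hf s hs).differentiableAt.differentiableWithinAt) (fun s hs => (hf s hs).deriv)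

namespace BCV

open CoordGeom

theorem exists_rotation {p : Fin 3 → ℝ} {x y : ℝ} (hp : p 0 ^ 2 + p 1 ^ 2 ≠ 0)
    (h : x ^ 2 + y ^ 2 = p 0 ^ 2 + p 1 ^ 2) : ∃ θ, rotation θ p 0 = x ∧ rotation θ p 1 = y := by
  have e : ((p 0 * x + p 1 * y) / (p 0 ^ 2 + p 1 ^ 2)) ^ 2
      + ((p 0 * y - p 1 * x) / (p 0 ^ 2 + p 1 ^ 2)) ^ 2 = 1 := by
    field_simp
    linear_combination (p 0 ^ 2 + p 1 ^ 2) * h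
  obtain ⟨θ, hc, hs⟩ := exists_eq_cos_sin e
  refine ⟨θ, ?_, ?_⟩ <;> simp only [rotation, ← hc, ← hs, Matrix.cons_val] <;> field_simp <;> ring

namespace HopfCylinder

variable {a b : ℝ} (M : HopfCylinder a b)

theorem hasDerivAt_curve {s : ℝ} (hs : s ∈ M.I) : HasDerivAt M.α (deriv M.α s) s :=
  ((M.isUnitSpeedCurve.contDiffOn.contDiffAt (M.isUnitSpeedCurve.isOpen.mem_nhds hs)).differentiableAt
    (by simp)).hasDerivAt

theorem hasDerivAt_curve_apply {s : ℝ} (hs : s ∈ M.I) (i : Fin 3) :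
    HasDerivAt (fun s => M.α s i) (deriv M.α s i) s :=
  hasDerivAt_pi.1 (M.hasDerivAt_curve hs) i

theorem param_apply (u : Fin 2 → ℝ) :
    M.param u = ![M.α (u 0) 0, M.α (u 0) 1, M.α (u 0) 2 + u 1] := by
  ext i
  fin_cases i <;> simp [param, verticalFlow, E3]

/-- A `C¹` image of an interval has Hausdorff dimension at most one, which is less than the
dimension of the plane. -/
theorem dense_compl_projection :
    Dense ((fun s => (M.α s 0, M.α s 1)) '' M.I)ᶜ := by
  have hα := (M.isUnitSpeedCurve.contDiffOn).of_le (m := 1) (by simp)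
  rw [contDiffOn_pi] at hα
  refine ((hα 0).prodMk (hα 1)).dense_compl_image_of_dimH_lt_finrank
    M.isUnitSpeedCurve.ordConnected.convex subset_rfl ?_
  refine (dimH_mono (Set.subset_univ _)).trans_lt ?_
  rw [Real.dimH_univ]
  simp

/-- By the intermediate value theorem every radius between the two is attained, and rotations then
fill the open annulus `O` with points of the projected curve, against the density of the complement.
-/
theorem not_radius_lt {M : HopfCylinder a b} (hrot : M.IsRotational) {s t : ℝ} (hs : s ∈ M.I)
    (ht : t ∈ M.I) : ¬ (M.α s 0 ^ 2 + M.α s 1 ^ 2 < M.α t 0 ^ 2 + M.α t 1 ^ 2) := by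
  intro hlt
  let O : Set (ℝ × ℝ) := {q | M.α s 0 ^ 2 + M.α s 1 ^ 2 < q.1 ^ 2 + q.2 ^ 2} ∩
    {q | q.1 ^ 2 + q.2 ^ 2 < M.α t 0 ^ 2 + M.α t 1 ^ 2}
  have hO : IsOpen O :=
    (isOpen_lt continuous_const (by fun_prop)).inter (isOpen_lt (by fun_prop) continuous_const)
  obtain ⟨m, hm1, hm2⟩ := exists_between hlt
  have hm0 : 0 ≤ m := by nlinarith [sq_nonneg (M.α s 0), sq_nonneg (M.α s 1)]
  have hne : O.Nonempty := ⟨(Real.sqrt m, 0), by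
    constructor <;> simpa [Real.sq_sqrt hm0]⟩
  obtain ⟨q, hqO, hq⟩ := M.dense_compl_projection.exists_mem_open hO hne |>.imp fun q h => h.symm
  refine hq ?_
  have hcont : ContinuousOn (fun s => M.α s 0 ^ 2 + M.α s 1 ^ 2) M.I := fun s hs =>
    (((M.hasDerivAt_curve_apply hs 0).pow 2).add
      ((M.hasDerivAt_curve_apply hs 1).pow 2)).continuousAt.continuousWithinAt
  obtain ⟨v, hv, hvq⟩ := M.isUnitSpeedCurve.ordConnected.isPreconnected.intermediate_value hs ht
    hcont ⟨hqO.1.le, hqO.2.le⟩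
  have hpos : M.α v 0 ^ 2 + M.α v 1 ^ 2 ≠ 0 := by
    have := hqO.1
    simp only [Set.mem_ofPred_eq] at this hvq
    nlinarith [sq_nonneg (M.α s 0), sq_nonneg (M.α s 1)]
  obtain ⟨θ, h0, h1⟩ := exists_rotation hpos hvq.symm
  have hmem : M.α v ∈ M.param '' M.domain := ⟨![v, 0], hv, by
    ext i; fin_cases i <;> simp [param_apply]⟩
  obtain ⟨u, hu, e⟩ := hrot θ _ hmem
  refine ⟨u 0, hu, ?_⟩
  refine Prod.ext (Eq.trans ?_ h0) (Eq.trans ?_ h1) <;> rw [← e, param_apply] <;> rfl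

theorem radius_eq {M : HopfCylinder a b} (hrot : M.IsRotational) {s t : ℝ} (hs : s ∈ M.I)
    (ht : t ∈ M.I) : M.α s 0 ^ 2 + M.α s 1 ^ 2 = M.α t 0 ^ 2 + M.α t 1 ^ 2 :=
  le_antisymm (not_lt.1 (not_radius_lt hrot ht hs)) (not_lt.1 (not_radius_lt hrot hs ht))

theorem deriv_curve_two {s : ℝ} (hs : s ∈ M.I) :
    deriv M.α s 2 = -(b / 2 * (M.α s 1 / lam a (M.α s)) * deriv M.α s 0
      - b / 2 * (M.α s 0 / lam a (M.α s)) * deriv M.α s 1) := by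
  have := M.orthogonal s hs
  rw [inner_metric] at this
  simp [E3] at this
  linarith

theorem speed_sq {s : ℝ} (hs : s ∈ M.I) :
    deriv M.α s 0 ^ 2 + deriv M.α s 1 ^ 2 = lam a (M.α s) ^ 2 := by
  have h := M.isUnitSpeedCurve.unit_speed s hs
  have h0 : lam a (M.α s) ≠ 0 := ne_of_gt (M.isUnitSpeedCurve.mapsTo hs)
  rw [inner_metric, M.deriv_curve_two hs] at h
  field_simp at h
  linear_combination h / 4

/-- The base curve of a rotational Hopf cylinder is a helix. -/
theorem exists_curve_eq_helix {M : HopfCylinder a b} (hrot : M.IsRotational) :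
    ∃ r k φ c : ℝ, 0 < r ∧ 0 < 1 + a * r ^ 2 ∧ (k * r / (1 + a * r ^ 2)) ^ 2 = 1 ∧
      Set.EqOn M.α (helix r k φ (b / 2 * k * r ^ 2 / (1 + a * r ^ 2)) c) M.I := by
  have hI := M.isUnitSpeedCurve.isOpen
  have hI' := M.isUnitSpeedCurve.ordConnected
  obtain ⟨s₀, hs₀⟩ := M.isUnitSpeedCurve.nonempty
  obtain ⟨ρ, hrad⟩ : ∃ ρ, ∀ s ∈ M.I, M.α s 0 ^ 2 + M.α s 1 ^ 2 = ρ :=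
    ⟨_, fun s hs => radius_eq hrot hs hs₀⟩
  have hρ : 0 ≤ ρ := hrad s₀ hs₀ ▸ by positivity
  have hlam : ∀ s ∈ M.I, lam a (M.α s) = 1 + a * ρ := fun s hs => by rw [lam, hrad s hs]
  have hL : 0 < 1 + a * ρ := hlam s₀ hs₀ ▸ M.isUnitSpeedCurve.mapsTo hs₀
  have hspeed : ∀ s ∈ M.I, deriv M.α s 0 ^ 2 + deriv M.α s 1 ^ 2 = (1 + a * ρ) ^ 2 :=
    fun s hs => by rw [M.speed_sq hs, hlam s hs]
  have horth : ∀ s ∈ M.I, M.α s 0 * deriv M.α s 0 + M.α s 1 * deriv M.α s 1 = 0 := by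
    intro s hs
    have h1 := ((M.hasDerivAt_curve_apply hs 0).fun_pow 2).fun_add
      ((M.hasDerivAt_curve_apply hs 1).fun_pow 2)
    have h2 : HasDerivAt (fun s => M.α s 0 ^ 2 + M.α s 1 ^ 2) 0 s :=
      (hasDerivAt_const s ρ).congr_of_eventuallyEq
        (Filter.eventuallyEq_of_mem (hI.mem_nhds hs) hrad)
    have := h1.unique h2
    norm_num at this
    linarith
  -- Lagrange's identity for position and velocity, whose scalar product is zero.
  have hWsq : ∀ s ∈ M.I, (M.α s 0 * deriv M.α s 1 - M.α s 1 * deriv M.α s 0) ^ 2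
      = ρ * (1 + a * ρ) ^ 2 := fun s hs => by
    linear_combination (-(M.α s 0 * deriv M.α s 0 + M.α s 1 * deriv M.α s 1)) * horth s hs
      + ρ * hspeed s hs + (deriv M.α s 0 ^ 2 + deriv M.α s 1 ^ 2) * hrad s hs
  have hρpos : 0 < ρ := by
    refine lt_of_le_of_ne hρ fun h0 => ?_
    have hz : ∀ s ∈ M.I, M.α s 0 = 0 ∧ M.α s 1 = 0 := fun s hs => by
      have := hrad s hs
      constructor <;> nlinarith [sq_nonneg (M.α s 0), sq_nonneg (M.α s 1)]
    have hd : ∀ i : Fin 3, (∀ s ∈ M.I, M.α s i = 0) → deriv M.α s₀ i = 0 := fun i hi =>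
      (M.hasDerivAt_curve_apply hs₀ i).unique ((hasDerivAt_const s₀ (0 : ℝ)).congr_of_eventuallyEq
        (Filter.eventuallyEq_of_mem (hI.mem_nhds hs₀) hi))
    have := hspeed s₀ hs₀
    rw [hd 0 fun s hs => (hz s hs).1, hd 1 fun s hs => (hz s hs).2] at this
    nlinarith
  obtain ⟨r, hr, rfl⟩ : ∃ r, 0 < r ∧ r ^ 2 = ρ :=
    ⟨Real.sqrt ρ, Real.sqrt_pos.2 hρpos, Real.sq_sqrt hρpos.le⟩
  have hderiv : ContinuousOn (deriv M.α) M.I :=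
    (M.isUnitSpeedCurve.contDiffOn.continuousOn_deriv_of_isOpen hI (by simp))
  have hcoord : ∀ i, ContinuousOn (fun s => M.α s i) M.I := fun i s hs =>
    (M.hasDerivAt_curve_apply hs i).continuousAt.continuousWithinAt
  have hdcoord : ∀ i, ContinuousOn (fun s => deriv M.α s i) M.I := continuousOn_pi.1 hderiv
  have hWc : ContinuousOn
      (fun s => M.α s 0 * deriv M.α s 1 - M.α s 1 * deriv M.α s 0) M.I :=
    ((hcoord 0).mul (hdcoord 1)).sub ((hcoord 1).mul (hdcoord 0))
  -- The continuous determinant of position and velocity has constant nonzero square, hence constant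
  -- sign on the interval. The sign is that of the angular velocity `k`.
  obtain ⟨k, hk, hW⟩ : ∃ k, (k * r / (1 + a * r ^ 2)) ^ 2 = 1 ∧
      ∀ s ∈ M.I, M.α s 0 * deriv M.α s 1 - M.α s 1 * deriv M.α s 0 = k * r ^ 2 := by
    have hne : r * (1 + a * r ^ 2) ≠ 0 := by positivity
    have hr0 := hr.ne'
    have hL0 := hL.ne'
    rcases hI'.isPreconnected.eq_or_eq_neg_of_sq_eq hWc
      (continuousOn_const (c := r * (1 + a * r ^ 2)))
      (fun s hs => by simpa [mul_pow] using hWsq s hs) (fun _ => hne) with h | h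
    · refine ⟨(1 + a * r ^ 2) / r, by field_simp, fun s hs => (h hs).trans ?_⟩
      field_simp
    · refine ⟨-((1 + a * r ^ 2) / r), by field_simp, fun s hs => (h hs).trans ?_⟩
      simp only [Pi.neg_apply]
      field_simp
  have hr2 : r ^ 2 ≠ 0 := by positivity
  have hx : ∀ s ∈ M.I, deriv M.α s 0 = -(k * M.α s 1) := fun s hs => by
    refine mul_left_cancel₀ hr2 ?_
    linear_combination M.α s 0 * horth s hs - M.α s 1 * hW s hs - deriv M.α s 0 * hrad s hs
  have hy : ∀ s ∈ M.I, deriv M.α s 1 = k * M.α s 0 := fun s hs => by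
    refine mul_left_cancel₀ hr2 ?_
    linear_combination M.α s 1 * horth s hs + M.α s 0 * hW s hs - deriv M.α s 1 * hrad s hs
  have hz : ∀ s ∈ M.I, deriv M.α s 2 = b / 2 * k * r ^ 2 / (1 + a * r ^ 2) := fun s hs => by
    rw [M.deriv_curve_two hs, hx s hs, hy s hs, hlam s hs]
    linear_combination (b / 2 * k / (1 + a * r ^ 2)) * hrad s hs
  have hcos : ∀ s, HasDerivAt (fun s => Real.cos (k * s)) (-(Real.sin (k * s)) * k) s := fun s => by
    simpa using ((hasDerivAt_id s).const_mul k).cos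
  have hsin : ∀ s, HasDerivAt (fun s => Real.sin (k * s)) (Real.cos (k * s) * k) s := fun s => by
    simpa using ((hasDerivAt_id s).const_mul k).sin
  -- Undoing the rotation by the angle `k s` gives constants, namely `X = r sin φ` and `Y = r cos
  -- φ`.
  obtain ⟨X, hX⟩ := exists_const_of_hasDerivAt_zero hI hI'
    (f := fun s => M.α s 0 * Real.cos (k * s) + M.α s 1 * Real.sin (k * s)) fun s hs => by
      refine (((M.hasDerivAt_curve_apply hs 0).mul (hcos s)).add
        ((M.hasDerivAt_curve_apply hs 1).mul (hsin s))).congr_deriv ?_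
      rw [hx s hs, hy s hs]
      ring
  obtain ⟨Y, hY⟩ := exists_const_of_hasDerivAt_zero hI hI'
    (f := fun s => M.α s 0 * Real.sin (k * s) - M.α s 1 * Real.cos (k * s)) fun s hs => by
      refine (((M.hasDerivAt_curve_apply hs 0).mul (hsin s)).sub
        ((M.hasDerivAt_curve_apply hs 1).mul (hcos s))).congr_deriv ?_
      rw [hx s hs, hy s hs]
      ring
  obtain ⟨c, hc⟩ := exists_const_of_hasDerivAt_zero hI hI'
    (f := fun s => M.α s 2 - b / 2 * k * r ^ 2 / (1 + a * r ^ 2) * s) fun s hs => by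
      refine ((M.hasDerivAt_curve_apply hs 2).sub
        ((hasDerivAt_id s).const_mul _)).congr_deriv ?_
      rw [hz s hs]
      ring
  have hXY : (Y / r) ^ 2 + (X / r) ^ 2 = 1 := by
    have h1 := hX s₀ hs₀
    have h2 := hY s₀ hs₀
    have h3 := hrad s₀ hs₀
    have h4 := Real.sin_sq_add_cos_sq (k * s₀)
    rw [← h1, ← h2]
    field_simp
    linear_combination h3 + (M.α s₀ 0 ^ 2 + M.α s₀ 1 ^ 2) * h4
  obtain ⟨φ, hφc, hφs⟩ := exists_eq_cos_sin hXY
  have hr0 := hr.ne'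
  refine ⟨r, k, φ, c, hr, hL, hk, fun s hs => ?_⟩
  have h1 := hX s hs
  have h2 := hY s hs
  have h3 := hc s hs
  have h4 := Real.sin_sq_add_cos_sq (k * s)
  ext i
  fin_cases i
  · simp only [helix, Real.sin_add, ← hφc, ← hφs]
    simp
    field_simp
    linear_combination Real.cos (k * s) * h1 + Real.sin (k * s) * h2 - M.α s 0 * h4
  · simp only [helix, Real.cos_add, ← hφc, ← hφs]
    simp
    field_simp
    linear_combination Real.sin (k * s) * h1 - Real.cos (k * s) * h2 - M.α s 1 * h4
  · simp [helix]
    linarith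

end HopfCylinder

end BCV

/-! ### Flatness of Hopf cylinders and their geodesics. -/

namespace BCV

open CoordGeom

namespace HopfCylinder

variable {a b : ℝ} (M : HopfCylinder a b)

theorem isOpen_domain : IsOpen M.domain :=
  M.isUnitSpeedCurve.isOpen.preimage (continuous_apply 0)

theorem hasFDerivAt_param {u : Fin 2 → ℝ} (hu : u ∈ M.domain) :
    HasFDerivAt M.param ((ContinuousLinearMap.proj (R := ℝ) (φ := fun _ : Fin 2 => ℝ) 0).smulRight
      (deriv M.α (u 0)) + (ContinuousLinearMap.proj (R := ℝ) (φ := fun _ : Fin 2 => ℝ) 1).smulRight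
      E3) u := by
  have h0 := (M.hasDerivAt_curve hu).hasFDerivAt.comp u
    (hasFDerivAt_apply (𝕜 := ℝ) (0 : Fin 2) u)
  have h1 := (hasFDerivAt_apply (𝕜 := ℝ) (1 : Fin 2) u).smul_const E3
  refine (h0.add h1).congr_fderiv ?_
  ext v i
  simp

theorem partialDeriv_param_zero {u : Fin 2 → ℝ} (hu : u ∈ M.domain) :
    partialDeriv 0 M.param u = deriv M.α (u 0) := by
  rw [partialDeriv_eq_of_hasFDerivAt 0 (M.hasFDerivAt_param hu)]
  simp

theorem partialDeriv_param_one {u : Fin 2 → ℝ} (hu : u ∈ M.domain) :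
    partialDeriv 1 M.param u = E3 := by
  rw [partialDeriv_eq_of_hasFDerivAt 1 (M.hasFDerivAt_param hu)]
  simp

theorem inner_param (u : Fin 2 → ℝ) (v w : Fin 3 → ℝ) :
    CoordGeom.inner (metric a b) (M.param u) v w
      = CoordGeom.inner (metric a b) (M.α (u 0)) v w := by
  simp [inner_metric, param_apply, lam]

theorem inner_comm (p v w : Fin 3 → ℝ) :
    CoordGeom.inner (metric a b) p v w = CoordGeom.inner (metric a b) p w v := by
  simp only [inner_metric]
  ring

/-- Hopf cylinders are flat: their coordinates `(s, t)` are Euclidean. -/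
theorem pullback_param {u : Fin 2 → ℝ} (hu : u ∈ M.domain) :
    pullback (metric a b) M.param u = 1 := by
  have h01 := M.orthogonal _ hu
  have h00 := M.isUnitSpeedCurve.unit_speed _ hu
  ext i j
  rw [pullback, Matrix.of_apply, inner_param]
  fin_cases i <;> fin_cases j <;>
    simp only [Fin.zero_eta, Fin.mk_one, partialDeriv_param_zero M hu, partialDeriv_param_one M hu]
  · simpa using h00
  · simpa using h01
  · rw [inner_comm]
    simpa using h01
  · simp [inner_metric, E3]

theorem christoffel_pullback_param {u : Fin 2 → ℝ} (hu : u ∈ M.domain) (k i j : Fin 2) :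
    christoffel (pullback (metric a b) M.param) k i j u = 0 := by
  have h : ∀ i j l, partialDeriv i (fun q => pullback (metric a b) M.param q j l) u = 0 := by
    intro i j l
    rw [partialDeriv_congr i (g := fun _ => (1 : Matrix (Fin 2) (Fin 2) ℝ) j l),
      partialDeriv_const]
    filter_upwards [M.isOpen_domain.mem_nhds hu] with q hq
    rw [pullback_param M hq]
  simp [christoffel, h]

theorem inner_pullback_param {u : Fin 2 → ℝ} (hu : u ∈ M.domain) (v w : Fin 2 → ℝ) :
    CoordGeom.inner (pullback (metric a b) M.param) u v w = v 0 * w 0 + v 1 * w 1 := by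
  simp [CoordGeom.inner, pullback_param M hu, Fin.sum_univ_two]

theorem covDeriv_pullback_param {u V : ℝ → Fin 2 → ℝ} {s : ℝ} (hs : u s ∈ M.domain) :
    covDeriv (pullback (metric a b) M.param) u V s = deriv V s := by
  ext k
  simp [covDeriv, christoffel_pullback_param M hs]

/-- A parametrized line in the plane. -/
def line (A B C D s : ℝ) : Fin 2 → ℝ := ![A * s + B, C * s + D]

theorem hasDerivAt_line (A B C D s : ℝ) : HasDerivAt (line A B C D) ![A, C] s := by
  rw [hasDerivAt_pi]
  intro i
  fin_cases i
  · simpa [line] using ((hasDerivAt_id s).const_mul A).add_const B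
  · simpa [line] using ((hasDerivAt_id s).const_mul C).add_const D

theorem deriv_line (A B C D : ℝ) : deriv (line A B C D) = fun _ => ![A, C] :=
  funext fun s => (hasDerivAt_line A B C D s).deriv

theorem contDiff_line (A B C D : ℝ) : ContDiff ℝ ∞ (line A B C D) := by
  rw [contDiff_pi]
  intro i
  fin_cases i <;> simp [line] <;> fun_prop

theorem isGeodesic_line {A B C D : ℝ} (h : A ^ 2 + C ^ 2 = 1) {J : Set ℝ} (hJ : IsOpen J)
    (hJ' : J.OrdConnected) (hne : J.Nonempty) (hmaps : ∀ s ∈ J, A * s + B ∈ M.I) :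
    IsGeodesic (pullback (metric a b) M.param) M.domain J (line A B C D) := by
  have hm : Set.MapsTo (line A B C D) J M.domain := hmaps
  refine ⟨⟨hJ, hJ', hne, (contDiff_line A B C D).contDiffOn, hm, fun s hs => ?_⟩, fun s hs => ?_⟩
  · rw [inner_pullback_param M (hm hs), deriv_line]
    simp only [Matrix.cons_val]
    linarith
  · rw [covDeriv_pullback_param M (hm hs), deriv_line]
    simp

theorem exists_eq_line_of_isGeodesic {J : Set ℝ} {u : ℝ → Fin 2 → ℝ}
    (h : IsGeodesic (pullback (metric a b) M.param) M.domain J u) :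
    ∃ A B C D : ℝ, A ^ 2 + C ^ 2 = 1 ∧ Set.EqOn u (line A B C D) J := by
  obtain ⟨hu, hgeo⟩ := h
  obtain ⟨s₀, hs₀⟩ := hu.nonempty
  have hd : ContDiffOn ℝ ∞ (deriv u) J := hu.contDiffOn.deriv_of_isOpen hu.isOpen (by simp)
  have h2 : ∀ i, ∀ s ∈ J, HasDerivAt (fun s => deriv u s i) 0 s := fun i s hs => by
    have := ((hd.contDiffAt (hu.isOpen.mem_nhds hs)).differentiableAt (by simp)).hasDerivAt
    rw [← covDeriv_pullback_param M (hu.mapsTo hs), hgeo s hs] at this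
    exact hasDerivAt_pi.1 this i
  have h1 : ∀ i, ∀ s ∈ J, HasDerivAt (fun s => u s i) (deriv u s i) s := fun i s hs =>
    hasDerivAt_pi.1 ((hu.contDiffOn.contDiffAt
      (hu.isOpen.mem_nhds hs)).differentiableAt (by simp)).hasDerivAt i
  have haff : ∀ i, ∃ A B : ℝ, ∀ s ∈ J, deriv u s i = A ∧ u s i = A * s + B := fun i => by
    obtain ⟨A, hA⟩ := exists_const_of_hasDerivAt_zero hu.isOpen hu.ordConnected (h2 i)
    obtain ⟨B, hB⟩ := exists_const_of_hasDerivAt_zero hu.isOpen hu.ordConnected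
      (f := fun s => u s i - A * s) fun s hs => by
        refine ((h1 i s hs).sub ((hasDerivAt_id s).const_mul A)).congr_deriv ?_
        rw [hA s hs]
        ring
    exact ⟨A, B, fun s hs => ⟨hA s hs, by linarith [hB s hs]⟩⟩
  obtain ⟨A, B, hAB⟩ := haff 0
  obtain ⟨C, D, hCD⟩ := haff 1
  refine ⟨A, B, C, D, ?_, fun s hs => ?_⟩
  · have := hu.unit_speed s₀ hs₀
    rw [inner_pullback_param M (hu.mapsTo hs₀), (hAB s₀ hs₀).1, (hCD s₀ hs₀).1] at this
    linarith
  · ext i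
    fin_cases i
    · exact (hAB s hs).2
    · exact (hCD s hs).2

end HopfCylinder

/-! ### Biharmonicity of the geodesics of a Hopf cylinder over a helix. -/

theorem helix_comp_line (r k φ ν c A B C D s : ℝ) :
    helix r k φ ν c (A * s + B) + (C * s + D) • E3
      = helix r (k * A) (k * B + φ) (ν * A + C) (ν * B + c + D) s := by
  ext i
  fin_cases i
  · simp [helix, E3, mul_add, mul_assoc, add_assoc]
  · simp [helix, E3, mul_add, mul_assoc, add_assoc]
  · simp [helix, E3]; ring

/-- Lines of unit velocity `(A, C)` in the flat coordinates of a Hopf cylinder over a helix become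
helices. -/
theorem HopfCylinder.param_line {a b : ℝ} (M : HopfCylinder a b) {r k φ ν c : ℝ}
    (hα : Set.EqOn M.α (helix r k φ ν c) M.I) {A B C D s : ℝ} (hs : A * s + B ∈ M.I) :
    M.param (HopfCylinder.line A B C D s)
      = helix r (k * A) (k * B + φ) (ν * A + C) (ν * B + c + D) s := by
  rw [← helix_comp_line, ← hα hs]
  rfl

theorem isUnitSpeedCurve_helix {a b r k φ ν c C : ℝ} (h : 0 < 1 + a * r ^ 2)
    (hν : ν = C + b / 2 * k * r ^ 2 / (1 + a * r ^ 2))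
    (hk : (k * r / (1 + a * r ^ 2)) ^ 2 + C ^ 2 = 1) {J : Set ℝ} (hJ : IsOpen J)
    (hJ' : J.OrdConnected) (hne : J.Nonempty) :
    IsUnitSpeedCurve (metric a b) (space a) J (helix r k φ ν c) where
  isOpen := hJ
  ordConnected := hJ'
  nonempty := hne
  contDiffOn := contDiff_helix.contDiffOn
  mapsTo := fun s _ => helix_mem_space h s
  unit_speed := fun s _ => by rw [inner_deriv_helix h C hν, hk]

theorem radial_ne_zero {r k φ ν c : ℝ} (hr : r ≠ 0) (s : ℝ) : radial r k φ ν c s ≠ 0 := by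
  intro h
  have h0 := congrFun h 0
  have h1 := congrFun h 1
  have h2 := helix_sq r k φ ν c s
  simp only [radial, Matrix.cons_val_zero, Matrix.cons_val_one, Pi.zero_apply] at h0 h1
  rw [h0, h1] at h2
  exact hr (by simpa using h2.symm)

namespace HopfCylinder

variable {a b : ℝ} {M : HopfCylinder a b} {r k φ c : ℝ}

/-- The base curve lies over the equator of the sphere, and the coefficient of `∇_t t` vanishes in
every direction. This is the case to be excluded in `TotallyBiharmonic.radius_eq`. -/
theorem totallyGeodesic_of_radius (hL : 0 < 1 + a * r ^ 2)
    (hk : (k * r / (1 + a * r ^ 2)) ^ 2 = 1)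
    (hα : Set.EqOn M.α (helix r k φ (b / 2 * k * r ^ 2 / (1 + a * r ^ 2)) c) M.I)
    (hb : b = 0) (har : a * r ^ 2 = 1) : M.TotallyGeodesic := by
  intro J u hu
  obtain ⟨A, B, C, D, hAC, hline⟩ := M.exists_eq_line_of_isGeodesic hu
  have he : Set.EqOn (fun s => M.param (u s)) (helix r (k * A) (k * B + φ) _ _) J := fun s hs => by
    have hm := hu.1.mapsTo hs
    rw [hline hs] at hm
    simpa only [hline hs] using M.param_line hα (C := C) (D := D) hm
  have hν : b / 2 * k * r ^ 2 / (1 + a * r ^ 2) * A + C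
      = C + b / 2 * (k * A) * r ^ 2 / (1 + a * r ^ 2) := by ring
  refine ⟨(isUnitSpeedCurve_helix hL hν ?_ hu.1.isOpen hu.1.ordConnected hu.1.nonempty).congr he,
    fun s hs => ?_⟩
  · linear_combination A ^ 2 * hk + hAC
  · rw [covDeriv_deriv_eqOn hu.1.isOpen he hs, covDeriv_deriv_helix hL C hν, hb, har]
    simp

/-- For `b = 0` the scalar `C` drops out of the bitension coefficient, leaving one factor that is
common to all directions. -/
theorem totallyBiharmonic_of_radius (hL : 0 < 1 + a * r ^ 2)
    (hk : (k * r / (1 + a * r ^ 2)) ^ 2 = 1)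
    (hα : Set.EqOn M.α (helix r k φ (b / 2 * k * r ^ 2 / (1 + a * r ^ 2)) c) M.I)
    (hb : b = 0) (har : (1 - a * r ^ 2) ^ 2 = 4 * a * r ^ 2) : M.TotallyBiharmonic := by
  intro J u hu
  obtain ⟨A, B, C, D, hAC, hline⟩ := M.exists_eq_line_of_isGeodesic hu
  have he : Set.EqOn (fun s => M.param (u s)) (helix r (k * A) (k * B + φ) _ _) J := fun s hs => by
    have hm := hu.1.mapsTo hs
    rw [hline hs] at hm
    simpa only [hline hs] using M.param_line hα (C := C) (D := D) hm
  have hν : b / 2 * k * r ^ 2 / (1 + a * r ^ 2) * A + C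
      = C + b / 2 * (k * A) * r ^ 2 / (1 + a * r ^ 2) := by ring
  refine ⟨(isUnitSpeedCurve_helix hL hν ?_ hu.1.isOpen hu.1.ordConnected hu.1.nonempty).congr he,
    fun s hs => ?_⟩
  · linear_combination A ^ 2 * hk + hAC
  · rw [bitension_eqOn hu.1.isOpen he hs, bitension_helix hL C hν, hb]
    convert zero_smul ℝ _
    rw [div_pow, div_pow, har]
    ring

/-- The algebraic conditions for the line of unit velocity `(A, C)`. -/
theorem TotallyBiharmonic.bitension_coeff (h : M.TotallyBiharmonic) (hr : r ≠ 0)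
    (hL : 0 < 1 + a * r ^ 2)
    (hα : Set.EqOn M.α (helix r k φ (b / 2 * k * r ^ 2 / (1 + a * r ^ 2)) c) M.I)
    (hk : k ≠ 0) {A C : ℝ} (hAC : A ^ 2 + C ^ 2 = 1) (hA : A ≠ 0) :
    (b * C - k * A * ((1 - a * r ^ 2) / (1 + a * r ^ 2)))
      * (k * A * (4 * a - b ^ 2) * (r / (1 + a * r ^ 2)) ^ 2
        - k * A * ((1 - a * r ^ 2) / (1 + a * r ^ 2)) ^ 2
        + b * C * ((1 - a * r ^ 2) / (1 + a * r ^ 2))) = 0 := by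
  obtain ⟨s₀, hs₀⟩ := M.isUnitSpeedCurve.nonempty
  -- The largest domain on which the line through the origin with velocity `(A, C)` stays in the
  -- parameter strip. It is nonempty because `A ≠ 0`.
  let J : Set ℝ := {s | A * s + 0 ∈ M.I}
  have hJ : IsOpen J := M.isUnitSpeedCurve.isOpen.preimage (by fun_prop)
  have hmem : s₀ / A ∈ J := by
    change A * (s₀ / A) + 0 ∈ M.I
    rwa [add_zero, mul_div_cancel₀ _ hA]
  have hJ' : J.OrdConnected := by
    have hc := M.isUnitSpeedCurve.ordConnected.convex.linear_preimage (LinearMap.mulLeft ℝ A)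
    have hJA : J = LinearMap.mulLeft ℝ A ⁻¹' M.I := by
      ext s
      simp [J]
    exact hJA ▸ hc.ordConnected
  have hgeo := M.isGeodesic_line (B := 0) (D := 0) hAC hJ hJ' ⟨_, hmem⟩ (fun s hs => hs)
  have hbi := (h J _ hgeo).2 _ hmem
  have he : Set.EqOn (fun s => M.param (line A 0 C 0 s)) (helix r (k * A) (k * 0 + φ) _ _) J :=
    fun s hs => M.param_line hα hs
  have hν : b / 2 * k * r ^ 2 / (1 + a * r ^ 2) * A + C
      = C + b / 2 * (k * A) * r ^ 2 / (1 + a * r ^ 2) := by ring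
  rw [bitension_eqOn hJ he hmem, bitension_helix hL C hν] at hbi
  have := (smul_eq_zero.1 hbi).resolve_right (radial_ne_zero hr _)
  have hkA : k * A ≠ 0 := mul_ne_zero hk hA
  refine mul_left_cancel₀ (pow_ne_zero 2 hkA) ?_
  linear_combination this

/-- The base direction `(1, 0)` relates `w²` to `(4a - b²) m`. The oblique directions `(3/5, ±4/5)`,
a rational mirror pair with nonzero components, then detect `b`. -/
theorem TotallyBiharmonic.radius_eq (h : M.TotallyBiharmonic) (hr : 0 < r)
    (hL : 0 < 1 + a * r ^ 2) (hk : (k * r / (1 + a * r ^ 2)) ^ 2 = 1)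
    (hα : Set.EqOn M.α (helix r k φ (b / 2 * k * r ^ 2 / (1 + a * r ^ 2)) c) M.I)
    (hab : 4 * a ≠ b ^ 2) (hM : ¬ M.TotallyGeodesic) :
    b = 0 ∧ 0 < a ∧ (1 - a * r ^ 2) ^ 2 = 4 * a * r ^ 2 := by
  have hk0 : k ≠ 0 := by
    rintro rfl
    simp at hk
  have hcoeff := fun {A C : ℝ} => h.bitension_coeff hr.ne' hL hα hk0 (A := A) (C := C)
  have hng : ¬ (b = 0 ∧ a * r ^ 2 = 1) := fun hc =>
    hM (totallyGeodesic_of_radius hL hk hα hc.1 hc.2)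
  have hm : (r / (1 + a * r ^ 2)) ^ 2 ≠ 0 := by positivity
  have h10 := hcoeff (A := 1) (C := 0) (by norm_num) (by norm_num)
  have h34 := hcoeff (A := 3 / 5) (C := 4 / 5) (by norm_num) (by norm_num)
  have h43 := hcoeff (A := 3 / 5) (C := -(4 / 5)) (by norm_num) (by norm_num)
  set w := (1 - a * r ^ 2) / (1 + a * r ^ 2) with hw
  set m := (r / (1 + a * r ^ 2)) ^ 2 with hm'
  have hab' : 4 * a - b ^ 2 ≠ 0 := sub_ne_zero.2 hab
  -- If `w = 0`, an oblique direction forces `b = 0`, since `4a ≠ b²`; the surface is then totally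
  -- geodesic.
  have hw0 : w ≠ 0 := by
    intro h0
    rw [h0] at h34
    have har : a * r ^ 2 = 1 := by
      rcases div_eq_zero_iff.1 h0 with h | h <;> linarith
    have : b * (k * ((4 * a - b ^ 2) * m)) = 0 := by linear_combination (25 / 12) * h34
    have hb : b = 0 := by
      simpa [hk0, hab', hm] using this
    exact hng ⟨hb, har⟩
  have hwm : (4 * a - b ^ 2) * m = w ^ 2 := by
    have : k ^ 2 * w * ((4 * a - b ^ 2) * m - w ^ 2) = 0 := by linear_combination -h10
    have := (mul_eq_zero.1 this).resolve_left (mul_ne_zero (pow_ne_zero 2 hk0) hw0)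
    linarith
  -- By `hwm` the second factor reduces to a multiple of `b w`. Adding the conditions of the mirror
  -- pair cancels the terms linear in `b`.
  have hb : b = 0 := by
    have e1 : w * (b * (4 * b - 3 * k * w)) = 0 := by
      linear_combination (25 / 4) * h34 - (25 / 4) * (4 / 5 * b - k * (3 / 5) * w) * (k * (3 / 5)) * hwm
    have e2 : w * (b * (4 * b + 3 * k * w)) = 0 := by
      linear_combination (25 / 4) * h43 + (25 / 4) * (4 / 5 * b + k * (3 / 5) * w) * (k * (3 / 5)) * hwm
    have e3 : w * b ^ 2 = 0 := by linear_combination (e1 + e2) / 8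
    simpa [hw0] using e3
  have e : (1 - a * r ^ 2) ^ 2 = 4 * a * r ^ 2 := by
    rw [hb, hw, hm'] at hwm
    field_simp at hwm
    linear_combination -hwm
  refine ⟨hb, ?_, e⟩
  have hne : 1 - a * r ^ 2 ≠ 0 := fun h0 => hw0 (by rw [hw, h0, zero_div])
  have : 0 < 4 * a * r ^ 2 := e ▸ by positivity
  by_contra ha
  nlinarith [sq_nonneg r]

end HopfCylinder

/-- With `X = a r²` the equation is `X² - 6X + 1 = 0`. -/
theorem sq_one_sub_eq_iff {a r : ℝ} (ha : 0 < a) :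
    (1 - a * r ^ 2) ^ 2 = 4 * a * r ^ 2
      ↔ r ^ 2 = (3 + 2 * Real.sqrt 2) / a ∨ r ^ 2 = (3 - 2 * Real.sqrt 2) / a := by
  have h2 : Real.sqrt 2 ^ 2 = 2 := Real.sq_sqrt (by norm_num)
  rw [eq_div_iff ha.ne', eq_div_iff ha.ne', ← sub_eq_zero (a := r ^ 2 * a),
    ← sub_eq_zero (a := r ^ 2 * a), ← mul_eq_zero, ← sub_eq_zero]
  constructor <;> intro h
  · linear_combination h - 4 * h2
  · linear_combination h + 4 * h2

end BCV

/-! ### Isometric immersions into Euclidean space. -/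

namespace CoordGeom

variable {n : ℕ} {F : Type*} [NormedAddCommGroup F] [NormedSpace ℝ F]
  {f : (Fin n → ℝ) → F} {U : Set (Fin n → ℝ)} {p : Fin n → ℝ}

theorem contDiffOn_partialDeriv (hU : IsOpen U) (hf : ContDiffOn ℝ ∞ f U) (i : Fin n) :
    ContDiffOn ℝ ∞ (partialDeriv i f) U :=
  (hf.fderiv_of_isOpen hU (by simp)).clm_apply contDiffOn_const

theorem differentiableAt_of_contDiffOn (hU : IsOpen U) (hf : ContDiffOn ℝ ∞ f U) (hp : p ∈ U) :
    DifferentiableAt ℝ f p :=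
  (hf.contDiffAt (hU.mem_nhds hp)).differentiableAt (by simp)

theorem partialDeriv_comm (hU : IsOpen U) (hf : ContDiffOn ℝ ∞ f U) (hp : p ∈ U) (i j : Fin n) :
    partialDeriv i (partialDeriv j f) p = partialDeriv j (partialDeriv i f) p := by
  have hd : DifferentiableAt ℝ (fderiv ℝ f) p :=
    ((hf.fderiv_of_isOpen hU (m := ∞) (by simp)).contDiffAt (hU.mem_nhds hp)).differentiableAt
      (by simp)
  have h : ∀ i j : Fin n, partialDeriv i (partialDeriv j f) p
      = fderiv ℝ (fderiv ℝ f) p (Pi.single i 1) (Pi.single j 1) := fun i j => by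
    refine (partialDeriv_eq_of_hasFDerivAt i
      (hd.hasFDerivAt.clm_apply (hasFDerivAt_const (Pi.single j (1 : ℝ)) p))).trans ?_
    simp
  rw [h, h]
  refine ((hf.contDiffAt (hU.mem_nhds hp)).isSymmSndFDerivAt ?_).eq _ _
  rw [minSmoothness_of_isRCLikeNormedField]
  exact WithTop.coe_le_coe.2 (le_top : (2 : ℕ∞) ≤ ⊤)

theorem partialDeriv_apply {m : ℕ} {f : (Fin n → ℝ) → Fin m → ℝ} (hf : DifferentiableAt ℝ f p)
    (i : Fin n) (j : Fin m) : partialDeriv i f p j = partialDeriv i (fun q => f q j) p := by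
  rw [partialDeriv_eq_of_hasFDerivAt i (hasFDerivAt_pi'.1 hf.hasFDerivAt j)]
  rfl

theorem partialDeriv_eq_zero_of_eqOn {f : (Fin n → ℝ) → ℝ} {c : ℝ} (hU : IsOpen U)
    (h : ∀ q ∈ U, f q = c) (hp : p ∈ U) (i : Fin n) : partialDeriv i f p = 0 := by
  rw [partialDeriv_congr i (Filter.eventuallyEq_of_mem (hU.mem_nhds hp) h), partialDeriv_const]

theorem inner_one {m : ℕ} (p v w : Fin m → ℝ) :
    CoordGeom.inner (fun _ => 1) p v w = ∑ j, v j * w j := by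
  simp [CoordGeom.inner, Matrix.one_apply]

theorem partialDeriv_sum_mul {m : ℕ} {f g : (Fin n → ℝ) → Fin m → ℝ}
    (hf : DifferentiableAt ℝ f p) (hg : DifferentiableAt ℝ g p) (i : Fin n) :
    partialDeriv i (fun q => ∑ j, f q j * g q j) p
      = ∑ j, partialDeriv i f p j * g p j + ∑ j, f p j * partialDeriv i g p j := by
  have h : HasFDerivAt (fun q => ∑ j, f q j * g q j) _ p :=
    HasFDerivAt.fun_sum fun j _ =>
      (hasFDerivAt_pi'.1 hf.hasFDerivAt j).fun_mul (hasFDerivAt_pi'.1 hg.hasFDerivAt j)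
  rw [partialDeriv_eq_of_hasFDerivAt i h, ← Finset.sum_add_distrib]
  simp only [partialDeriv, sum_apply, add_apply, smul_apply, ContinuousLinearMap.comp_apply,
    ContinuousLinearMap.proj_apply, smul_eq_mul]
  exact Finset.sum_congr rfl fun j _ => by ring

/-- The Koszul formula for an immersion into Euclidean space. -/
theorem sum_partialDeriv_mul {m : ℕ} {g : MetricField n} {Φ : (Fin n → ℝ) → Fin m → ℝ}
    (hU : IsOpen U) (hΦ : ContDiffOn ℝ ∞ Φ U) (hg : ∀ q ∈ U, pullback (fun _ => 1) Φ q = g q)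
    (hp : p ∈ U) (i j l : Fin n) :
    ∑ k, partialDeriv i (partialDeriv j Φ) p k * partialDeriv l Φ p k
      = 1 / 2 * (partialDeriv i (fun q => g q j l) p + partialDeriv j (fun q => g q i l) p
        - partialDeriv l (fun q => g q i j) p) := by
  have hd : ∀ i, DifferentiableAt ℝ (partialDeriv i Φ) p := fun i =>
    differentiableAt_of_contDiffOn hU (contDiffOn_partialDeriv hU hΦ i) hp
  have h : ∀ i j l, partialDeriv i (fun q => g q j l) p
      = ∑ k, partialDeriv i (partialDeriv j Φ) p k * partialDeriv l Φ p k
        + ∑ k, partialDeriv j Φ p k * partialDeriv i (partialDeriv l Φ) p k := fun i j l => by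
    rw [← partialDeriv_sum_mul (hd j) (hd l)]
    refine partialDeriv_congr i ?_
    filter_upwards [hU.mem_nhds hp] with q hq
    rw [← hg q hq, pullback, Matrix.of_apply, inner_one]
  have e : ∀ i j l, ∑ k, partialDeriv j Φ p k * partialDeriv i (partialDeriv l Φ) p k
      = ∑ k, partialDeriv i (partialDeriv l Φ) p k * partialDeriv j Φ p k := fun i j l =>
    Finset.sum_congr rfl fun k _ => mul_comm _ _
  rw [h, h, h, e, e, e, partialDeriv_comm hU hΦ hp j i, partialDeriv_comm hU hΦ hp l i,
    partialDeriv_comm hU hΦ hp l j]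
  ring

end CoordGeom

/-! ### Functions with parallel gradient on `N(a, b)` for `b ≠ 0`. -/

namespace BCV

open CoordGeom

variable {a b : ℝ}

/-- A function on `N(a, b)`, `b ≠ 0`, whose gradient is parallel, has zero gradient. Only the
components of the Hessian that involve `∂/∂z` are needed. -/
theorem partialDeriv_eq_zero_of_hessian {f : (Fin 3 → ℝ) → ℝ} (hb : b ≠ 0)
    (hf : ContDiffOn ℝ ∞ f (space a))
    (h22 : ∀ p ∈ space a, partialDeriv 2 (partialDeriv 2 f) p = 0)
    (h02 : ∀ p ∈ space a, 2 * lam a p * partialDeriv 0 (partialDeriv 2 f) p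
      = -b * (lam a p * partialDeriv 1 f p + b / 2 * p 0 * partialDeriv 2 f p))
    (h12 : ∀ p ∈ space a, 2 * lam a p * partialDeriv 1 (partialDeriv 2 f) p
      = b * (lam a p * partialDeriv 0 f p - b / 2 * p 1 * partialDeriv 2 f p))
    {p : Fin 3 → ℝ} (hp : p ∈ space a) (i : Fin 3) : partialDeriv i f p = 0 := by
  have hU : IsOpen (space a) := isOpen_space
  have hf' := contDiffOn_partialDeriv hU hf
  have hf'' := fun i j => contDiffOn_partialDeriv hU (hf' i) j
  have hd : ∀ i, ∀ q ∈ space a, DifferentiableAt ℝ (partialDeriv i f) q := fun i q hq =>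
    differentiableAt_of_contDiffOn hU (hf' i) hq
  have hdd : ∀ i j, ∀ q ∈ space a, DifferentiableAt ℝ (partialDeriv j (partialDeriv i f)) q :=
    fun i j q hq => differentiableAt_of_contDiffOn hU (hf'' i j) hq
  have hlam : ∀ q ∈ space a, lam a q ≠ 0 := fun q hq => ne_of_gt hq
  have hcoord : ∀ (j : Fin 3) (q : Fin 3 → ℝ), DifferentiableAt ℝ (fun q : Fin 3 → ℝ => q j) q :=
    fun j q => differentiableAt_apply j q
  have hz : ∀ q ∈ space a, ∀ j, partialDeriv 2 (partialDeriv j (partialDeriv 2 f)) q = 0 :=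
    fun q hq j => by
      rw [partialDeriv_comm hU (hf' 2) hq]
      exact partialDeriv_eq_zero_of_eqOn hU h22 hq j
  have hlam2 : ∀ q, partialDeriv 2 (lam a) q = 0 := fun q => by simp [partialDeriv_lam]
  -- The `z`-derivatives of the last two hypotheses.
  have hc1 : ∀ q ∈ space a, partialDeriv 1 (partialDeriv 2 f) q = 0 := fun q hq => by
    have h := partialDeriv_congr 2 (Filter.eventuallyEq_of_mem (hU.mem_nhds hq) h02)
    rw [partialDeriv_mul 2 (differentiableAt_lam.const_mul 2) (hdd 2 0 q hq),
      partialDeriv_const_mul 2 _ ((differentiableAt_lam.fun_mul (hd 1 q hq)).fun_add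
        (((hcoord 0 q).const_mul _).fun_mul (hd 2 q hq))),
      partialDeriv_add 2 (differentiableAt_lam.fun_mul (hd 1 q hq))
        (((hcoord 0 q).const_mul _).fun_mul (hd 2 q hq)),
      partialDeriv_mul 2 differentiableAt_lam (hd 1 q hq),
      partialDeriv_mul 2 ((hcoord 0 q).const_mul _) (hd 2 q hq),
      partialDeriv_const_mul 2 _ differentiableAt_lam, partialDeriv_const_mul 2 _ (hcoord 0 q),
      partialDeriv_coord, hz q hq, h22 q hq, hlam2, partialDeriv_comm hU hf hq 2 1] at h
    simpa [hb, hlam q hq] using h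
  have hc0 : ∀ q ∈ space a, partialDeriv 0 (partialDeriv 2 f) q = 0 := fun q hq => by
    have h := partialDeriv_congr 2 (Filter.eventuallyEq_of_mem (hU.mem_nhds hq) h12)
    simp only [sub_eq_add_neg, ← neg_mul] at h
    rw [partialDeriv_mul 2 (differentiableAt_lam.const_mul 2) (hdd 2 1 q hq),
      partialDeriv_const_mul 2 _ ((differentiableAt_lam.fun_mul (hd 0 q hq)).fun_add
        (((hcoord 1 q).const_mul _).fun_mul (hd 2 q hq))),
      partialDeriv_add 2 (differentiableAt_lam.fun_mul (hd 0 q hq))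
        (((hcoord 1 q).const_mul _).fun_mul (hd 2 q hq)),
      partialDeriv_mul 2 differentiableAt_lam (hd 0 q hq),
      partialDeriv_mul 2 ((hcoord 1 q).const_mul _) (hd 2 q hq),
      partialDeriv_const_mul 2 _ differentiableAt_lam, partialDeriv_const_mul 2 _ (hcoord 1 q),
      partialDeriv_coord, hz q hq, h22 q hq, hlam2, partialDeriv_comm hU hf hq 2 0] at h
    simpa [hb, hlam q hq] using h
  -- Since the mixed derivatives vanish, the hypotheses say that the horizontal frame fields `E₁`
  -- and `E₂` annihilate `f`.
  have e1 : ∀ q ∈ space a,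
      lam a q * partialDeriv 1 f q = -(b / 2) * q 0 * partialDeriv 2 f q := fun q hq => by
    have := h02 q hq
    rw [hc0 q hq] at this
    refine mul_left_cancel₀ hb ?_
    linear_combination this
  have e0 : ∀ q ∈ space a,
      lam a q * partialDeriv 0 f q = b / 2 * q 1 * partialDeriv 2 f q := fun q hq => by
    have := h12 q hq
    rw [hc1 q hq] at this
    refine mul_left_cancel₀ hb ?_
    linear_combination -this
  -- Comparing the mixed `xy`-derivatives amounts to applying `[E₁, E₂] = b E₃` to `f`, so `b ∂f/∂z
  -- = 0`.
  have d0 := partialDeriv_congr 0 (Filter.eventuallyEq_of_mem (hU.mem_nhds hp) e1)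
  have d1 := partialDeriv_congr 1 (Filter.eventuallyEq_of_mem (hU.mem_nhds hp) e0)
  rw [partialDeriv_mul 0 differentiableAt_lam (hd 1 p hp),
    partialDeriv_mul 0 ((hcoord 0 p).const_mul _) (hd 2 p hp), partialDeriv_lam,
    partialDeriv_const_mul 0 _ (hcoord 0 p), partialDeriv_coord, hc0 p hp] at d0
  rw [partialDeriv_mul 1 differentiableAt_lam (hd 0 p hp),
    partialDeriv_mul 1 ((hcoord 1 p).const_mul _) (hd 2 p hp), partialDeriv_lam,
    partialDeriv_const_mul 1 _ (hcoord 1 p), partialDeriv_coord, hc1 p hp,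
    partialDeriv_comm hU hf hp 1 0] at d1
  simp at d0 d1
  have hl : lam a p = 1 + a * (p 0 ^ 2 + p 1 ^ 2) := rfl
  have hc : partialDeriv 2 f p = 0 := by
    refine mul_left_cancel₀ hb ?_
    linear_combination lam a p * (d0 - d1) + 2 * a * p 1 * e0 p hp - 2 * a * p 0 * e1 p hp
      - b * partialDeriv 2 f p * hl
  fin_cases i
  · refine mul_left_cancel₀ (hlam p hp) ?_
    simpa [hc] using e0 p hp
  · refine mul_left_cancel₀ (hlam p hp) ?_
    simpa [hc] using e1 p hp
  · exact hc

end BCV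

/-! ### When `N(a, b)` is a punctured sphere times a line. -/

namespace BCV

open CoordGeom

variable {a b ρ : ℝ}

/-- For an isometric immersion of `N(a, b)` into `𝕊² × ℝ ⊆ ℝ⁴`, the image of the frame
`E₁, E₂, E₃` and a normal vector form an orthonormal basis of `ℝ⁴`, whose last member is orthogonal
to the axis. -/
theorem sum_axis_component_mul_inner {Φ : (Fin 3 → ℝ) → Fin 4 → ℝ} (hρ : 0 < ρ)
    (hΦ : ContDiffOn ℝ ∞ Φ (space a))
    (hS : ∀ p ∈ space a, Φ p 0 ^ 2 + Φ p 1 ^ 2 + Φ p 2 ^ 2 = 1 / ρ)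
    (hg : ∀ p ∈ space a, pullback (fun _ => 1) Φ p = metric a b p)
    {p : Fin 3 → ℝ} (hp : p ∈ space a) (w : Fin 4 → ℝ) :
    w 3 = (lam a p * partialDeriv 0 Φ p 3 - b / 2 * p 1 * partialDeriv 2 Φ p 3)
          * (lam a p * ∑ j, w j * partialDeriv 0 Φ p j
            - b / 2 * p 1 * ∑ j, w j * partialDeriv 2 Φ p j)
        + (lam a p * partialDeriv 1 Φ p 3 + b / 2 * p 0 * partialDeriv 2 Φ p 3)
          * (lam a p * ∑ j, w j * partialDeriv 1 Φ p j
            + b / 2 * p 0 * ∑ j, w j * partialDeriv 2 Φ p j)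
        + partialDeriv 2 Φ p 3 * ∑ j, w j * partialDeriv 2 Φ p j := by
  have hd := differentiableAt_of_contDiffOn isOpen_space hΦ hp
  have hl : lam a p ≠ 0 := ne_of_gt hp
  -- Differentiating the equation of the sphere shows that its position vector is normal to the
  -- image.
  have hN : ∀ i, Φ p 0 * partialDeriv i Φ p 0 + Φ p 1 * partialDeriv i Φ p 1
      + Φ p 2 * partialDeriv i Φ p 2 = 0 := fun i => by
    have h0 := fun j => differentiableAt_pi.1 hd j
    have e : (fun q => Φ q 0 * Φ q 0 + (Φ q 1 * Φ q 1 + Φ q 2 * Φ q 2))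
        = fun q => Φ q 0 ^ 2 + Φ q 1 ^ 2 + Φ q 2 ^ 2 := by
      ext q; ring
    have h := partialDeriv_eq_zero_of_eqOn isOpen_space hS hp i
    rw [← e, partialDeriv_add i ((h0 0).fun_mul (h0 0))
      (((h0 1).fun_mul (h0 1)).fun_add ((h0 2).fun_mul (h0 2))),
      partialDeriv_add i ((h0 1).fun_mul (h0 1)) ((h0 2).fun_mul (h0 2)),
      partialDeriv_mul i (h0 0) (h0 0), partialDeriv_mul i (h0 1) (h0 1),
      partialDeriv_mul i (h0 2) (h0 2)] at h
    rw [partialDeriv_apply hd, partialDeriv_apply hd, partialDeriv_apply hd]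
    linarith
  have hG : ∀ i j, ∑ k, partialDeriv i Φ p k * partialDeriv j Φ p k = metric a b p i j :=
    fun i j => by rw [← hg p hp, pullback, Matrix.of_apply, inner_one]
  have hS' := hS p hp
  have hρ' : Real.sqrt ρ ^ 2 = ρ := Real.sq_sqrt hρ.le
  have hρ0 := hρ.ne'
  set X := partialDeriv 0 Φ p with hX
  set Y := partialDeriv 1 Φ p with hY
  set Z := partialDeriv 2 Φ p with hZ
  set N : Fin 4 → ℝ := ![Φ p 0, Φ p 1, Φ p 2, 0] with hNdef
  have hXX : X ⬝ᵥ X = _ := hG 0 0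
  have hXY : X ⬝ᵥ Y = _ := hG 0 1
  have hXZ : X ⬝ᵥ Z = _ := hG 0 2
  have hYY : Y ⬝ᵥ Y = _ := hG 1 1
  have hYZ : Y ⬝ᵥ Z = _ := hG 1 2
  have hZZ : Z ⬝ᵥ Z = _ := hG 2 2
  have hNi : ∀ i, N ⬝ᵥ partialDeriv i Φ p = 0 := fun i => by
    rw [← hN i]
    simp [hNdef, dotProduct, Fin.sum_univ_four]
  have hNN : N ⬝ᵥ N = 1 / ρ := by
    rw [← hS']
    simp [hNdef, dotProduct, Fin.sum_univ_four]
    ring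
  have hNX : N ⬝ᵥ X = 0 := hNi 0
  have hNY : N ⬝ᵥ Y = 0 := hNi 1
  have hNZ : N ⬝ᵥ Z = 0 := hNi 2
  let e : Fin 4 → Fin 4 → ℝ := ![lam a p • X - (b / 2 * p 1) • Z,
    lam a p • Y + (b / 2 * p 0) • Z, Z, Real.sqrt ρ • N]
  have hO : Matrix.of e * (Matrix.of e).transpose = 1 := by
    ext i j
    change e i ⬝ᵥ e j = _
    fin_cases i <;> fin_cases j <;>
      simp [e, hXX, hXY, hXZ, hYY, hYZ, hZZ, hNX, hNY, hNZ, hNN, dotProduct_comm Y X,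
        dotProduct_comm Z X, dotProduct_comm Z Y, dotProduct_comm X N, dotProduct_comm Y N,
        dotProduct_comm Z N, metric_apply, contactForm, conf] <;>
      field_simp <;> first | exact hρ' | ring
  -- Orthonormal rows make a square matrix orthogonal, so `w` expands in them. The normal row has
  -- last entry zero and does not contribute to `w 3`.
  have h := congrFun (congrArg (fun A => Matrix.mulVec A w) (mul_eq_one_comm.1 hO)) 3
  rw [Matrix.one_mulVec, ← Matrix.mulVec_mulVec] at h
  rw [← h]
  simp [e, Matrix.mulVec, dotProduct, Fin.sum_univ_four, hNdef]
  ring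

/-- The normal is orthogonal to the axis, so the second derivatives of the height `Φ · 3` are those
of a function with parallel gradient. The height then has zero differential, which makes the axis
orthogonal to every tangent vector, while it also has no normal component. -/
theorem not_isometric_of_ne_zero (hb : b ≠ 0) : ¬ IsometricToSphereTimesLine a b ρ := by
  rintro ⟨hρ, Φ, hΦ, hbij, hg⟩
  have hS : ∀ p ∈ space a, Φ p 0 ^ 2 + Φ p 1 ^ 2 + Φ p 2 ^ 2 = 1 / ρ := fun p hp =>
    (hbij.mapsTo hp).1
  have hU : IsOpen (space a) := isOpen_space
  have hbasis := fun {p} (hp : p ∈ space a) => sum_axis_component_mul_inner hρ hΦ hS hg hp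
  have hk := fun {p} (hp : p ∈ space a) => sum_partialDeriv_mul hU hΦ hg hp
  have hf : ContDiffOn ℝ ∞ (fun q => Φ q 3) (space a) := contDiffOn_pi.1 hΦ 3
  have h1 : ∀ q ∈ space a, ∀ i, partialDeriv i (fun q => Φ q 3) q = partialDeriv i Φ q 3 :=
    fun q hq i => (partialDeriv_apply (differentiableAt_of_contDiffOn hU hΦ hq) i 3).symm
  have h2 : ∀ q ∈ space a, ∀ i j, partialDeriv i (partialDeriv j (fun q => Φ q 3)) q
      = partialDeriv i (partialDeriv j Φ) q 3 := fun q hq i j => by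
    rw [partialDeriv_apply
      (differentiableAt_of_contDiffOn hU (contDiffOn_partialDeriv hU hΦ j) hq) i 3]
    exact partialDeriv_congr i
      (Filter.eventuallyEq_of_mem (hU.mem_nhds hq) fun q hq => h1 q hq j)
  have hzero : ∀ q ∈ space a, ∀ i, partialDeriv i Φ q 3 = 0 := fun q hq i => by
    rw [← h1 q hq i]
    refine partialDeriv_eq_zero_of_hessian hb hf (fun p hp => ?_) (fun p hp => ?_)
      (fun p hp => ?_) hq i
    all_goals
      have hl : lam a p = 1 + a * (p 0 ^ 2 + p 1 ^ 2) := rfl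
      have hl0 : lam a p ≠ 0 := ne_of_gt hp
      rw [hl] at hl0
      -- The expansion is applied to a second derivative of `Φ`; its scalar products with first
      -- derivatives are given by the Koszul formula `hk`.
      rw [h2 p hp, hbasis hp (partialDeriv _ (partialDeriv _ Φ) p)]
      simp only [h1 p hp, hk hp, partialDeriv_metric hp]
      simp [dcontact, contactForm_eq, dscaled, dconf, scaled, conf, hl]
      try field_simp
      try ring
  have h0 : (0 : Fin 3 → ℝ) ∈ space a := by simp [space, lam]
  -- For the axis vector the left side is `1`, while every term on the right vanishes.
  have := hbasis h0 (Pi.single 3 1)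
  simp [hzero 0 h0] at this

/-- The inverse of the stereographic projection, times the identity of the line. -/
def stereographic (d : ℝ) (p : Fin 3 → ℝ) : Fin 4 → ℝ :=
  ![scaled (d ^ 2) 0 p, scaled (d ^ 2) 1 p, 1 / (2 * d) + -1 / d * conf (d ^ 2) p, p 2]

theorem mem_space_sq (d : ℝ) (p : Fin 3 → ℝ) : p ∈ space (d ^ 2) := by
  change 0 < 1 + d ^ 2 * (p 0 ^ 2 + p 1 ^ 2)
  positivity

theorem contDiff_stereographic (d : ℝ) : ContDiff ℝ ∞ (stereographic d) := by
  have hc : ContDiff ℝ ∞ (conf (d ^ 2)) :=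
    contDiff_lam.inv fun p => ne_of_gt (mem_space_sq d p)
  rw [contDiff_pi]
  intro i
  fin_cases i <;> simp [stereographic, scaled] <;> fun_prop

theorem pullback_stereographic (d : ℝ) (p : Fin 3 → ℝ) :
    pullback (fun _ => 1) (stereographic d) p = metric (d ^ 2) 0 p := by
  have hp := mem_space_sq d p
  have hl0 : lam (d ^ 2) p ≠ 0 := ne_of_gt hp
  have hl : lam (d ^ 2) p = 1 + d ^ 2 * (p 0 ^ 2 + p 1 ^ 2) := rfl
  rw [hl] at hl0
  have hdiff : DifferentiableAt ℝ (stereographic d) p :=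
    (contDiff_stereographic d).differentiable (by simp) p
  have h : ∀ i, partialDeriv i (stereographic d) p
      = ![dscaled (d ^ 2) i 0 p, dscaled (d ^ 2) i 1 p, -1 / d * dconf (d ^ 2) i p,
        if 2 = i then 1 else 0] := fun i => by
    ext j
    rw [partialDeriv_apply hdiff]
    fin_cases j
    · exact partialDeriv_scaled hp i 0
    · exact partialDeriv_scaled hp i 1
    · refine (partialDeriv_add i (differentiableAt_const _)
        ((differentiableAt_conf hp).const_mul _)).trans ?_
      rw [partialDeriv_const, partialDeriv_const_mul i _ (differentiableAt_conf hp),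
        partialDeriv_conf hp, zero_add]
      rfl
    · exact partialDeriv_coord i 2 p
  ext i j
  rw [pullback, Matrix.of_apply, inner_one, metric_apply, h, h, Fin.sum_univ_four]
  fin_cases i <;> fin_cases j <;> simp [dscaled, dconf, conf, contactForm, hl] <;> field_simp <;>
    ring

theorem bijOn_stereographic {d : ℝ} (hd : 0 < d) :
    Set.BijOn (stereographic d) (space (d ^ 2)) (puncturedSphereTimesLine (4 * d ^ 2)) := by
  have hd0 := hd.ne'
  have hsqrt : Real.sqrt (4 * d ^ 2) = 2 * d := by
    rw [show 4 * d ^ 2 = (2 * d) ^ 2 by ring, Real.sqrt_sq (by positivity)]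
  have hlam : ∀ p, lam (d ^ 2) p ≠ 0 := fun p => ne_of_gt (mem_space_sq d p)
  refine ⟨fun p _ => ⟨?_, ?_⟩, fun p _ q _ h => ?_, fun q hq => ?_⟩
  · have hl0 := hlam p
    simp only [stereographic, scaled, conf, Matrix.cons_val]
    field_simp
    rw [lam]
    ring
  · rintro ⟨-, -, h⟩
    rw [hsqrt] at h
    simp only [stereographic, conf, Matrix.cons_val, add_eq_left] at h
    have := hlam p
    simp [hd0, this] at h
  · have h0 := congrFun h 0
    have h1 := congrFun h 1
    have h2 := congrFun h 2
    have h3 := congrFun h 3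
    simp only [stereographic, scaled, Matrix.cons_val, add_right_inj] at h0 h1 h2 h3
    have hc : conf (d ^ 2) p = conf (d ^ 2) q :=
      mul_left_cancel₀ (div_ne_zero (by norm_num) hd0) h2
    have hne : conf (d ^ 2) q ≠ 0 := inv_ne_zero (hlam q)
    rw [hc] at h0 h1
    ext i
    fin_cases i
    · exact mul_right_cancel₀ hne h0
    · exact mul_right_cancel₀ hne h1
    · exact h3
  · obtain ⟨hq1, hq2⟩ := hq
    rw [hsqrt] at hq2
    -- Solving the third coordinate for `conf` gives this value at the preimage; it would vanish
    -- only at the removed north pole.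
    have hm : (1 - 2 * d * q 2) / 2 ≠ 0 := by
      intro h0
      have h2 : q 2 = 1 / (2 * d) := by
        field_simp
        linarith
      have h01 : q 0 ^ 2 + q 1 ^ 2 = 0 := by
        rw [h2] at hq1
        field_simp at hq1
        have : 4 * d ^ 2 * (q 0 ^ 2 + q 1 ^ 2) = 0 := by linear_combination hq1 / 4
        exact (mul_eq_zero.1 this).resolve_left (by positivity)
      refine hq2 ⟨?_, ?_, h2⟩ <;> nlinarith [sq_nonneg (q 0), sq_nonneg (q 1)]
    obtain ⟨m, hmdef⟩ : ∃ m, m = (1 - 2 * d * q 2) / 2 := ⟨_, rfl⟩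
    rw [← hmdef] at hm
    have hconf : conf (d ^ 2) ![q 0 / m, q 1 / m, q 3] = m := by
      have e : d ^ 2 * (q 0 ^ 2 + q 1 ^ 2) = m * (1 - m) := by
        field_simp at hq1
        rw [hmdef]
        linear_combination hq1 / 4
      rw [conf, inv_eq_iff_eq_inv, lam]
      simp only [Matrix.cons_val]
      field_simp
      linear_combination e
    refine ⟨![q 0 / m, q 1 / m, q 3], mem_space_sq d _, ?_⟩
    ext i
    simp only [stereographic, scaled, hconf]
    fin_cases i
    · exact div_mul_cancel₀ _ hm
    · exact div_mul_cancel₀ _ hm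
    · change 1 / (2 * d) + -1 / d * m = q 2
      rw [hmdef]
      field_simp
      ring
    · rfl

theorem isometric_of_eq_zero (ha : 0 < a) : IsometricToSphereTimesLine a 0 (4 * a) := by
  obtain ⟨d, hd, rfl⟩ : ∃ d, 0 < d ∧ a = d ^ 2 :=
    ⟨Real.sqrt a, Real.sqrt_pos.2 ha, (Real.sq_sqrt ha.le).symm⟩
  exact ⟨by positivity, stereographic d, (contDiff_stereographic d).contDiffOn,
    bijOn_stereographic hd, fun p _ => pullback_stereographic d p⟩

theorem isometric_iff : IsometricToSphereTimesLine a b (4 * a) ↔ b = 0 ∧ 0 < a := by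
  constructor
  · intro h
    exact ⟨by_contra fun hb => not_isometric_of_ne_zero hb h, by linarith [h.1]⟩
  · rintro ⟨rfl, ha⟩
    exact isometric_of_eq_zero ha

end BCV

end

theorem proposition4 (a b : ℝ) (hab : 4 * a ≠ b ^ 2) (M : BCV.HopfCylinder a b)
    (hrot : M.IsRotational) (hM : ¬ M.TotallyGeodesic) :
    (BCV.IsometricToSphereTimesLine a b (4 * a) ↔ b = 0 ∧ 0 < a) ∧
    ∃ r : ℝ, 0 < r ∧
      (∀ (J : Set ℝ) (γ : ℝ → Fin 3 → ℝ), M.IsGeodesicOf J γ → BCV.IsHelix r J γ) ∧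
      (M.TotallyBiharmonic ↔
        BCV.IsometricToSphereTimesLine a b (4 * a) ∧
          (r ^ 2 = (3 + 2 * Real.sqrt 2) / a ∨ r ^ 2 = (3 - 2 * Real.sqrt 2) / a)) := by
  obtain ⟨r, k, φ, c, hr, hL, hk, hα⟩ := BCV.HopfCylinder.exists_curve_eq_helix hrot
  refine ⟨BCV.isometric_iff, r, hr, fun J γ => ?_, ?_⟩
  · rintro ⟨u, hu, hγ⟩
    obtain ⟨A, B, C, D, -, hline⟩ := M.exists_eq_line_of_isGeodesic hu
    have he : ∀ s ∈ J, γ s = BCV.helix r (k * A) _ _ _ s := fun s hs => by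
      have hm := hu.1.mapsTo hs
      rw [hline hs] at hm
      rw [hγ s hs, hline hs]
      exact M.param_line hα hm
    exact ⟨_, _, _, _, he⟩
  · rw [BCV.isometric_iff]
    constructor
    · intro h
      obtain ⟨hb, ha, e⟩ := BCV.HopfCylinder.TotallyBiharmonic.radius_eq h hr hL hk hα hab hM
      exact ⟨⟨hb, ha⟩, (BCV.sq_one_sub_eq_iff ha).1 e⟩
    · rintro ⟨⟨hb, ha⟩, e⟩
      exact BCV.HopfCylinder.totallyBiharmonic_of_radius hL hk hα hb
        ((BCV.sq_one_sub_eq_iff ha).2 e)
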